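/- **Notation.** Let $\langle n\rangle:=\max\{1,|n|\}$ and $e_n:=e^{inx}$. For $\beta\in\mathbb R$, let $H^\beta_c=H^\beta(\mathbb R/2\pi\mathbb Z,\mathbb C)$ be the Sobolev space of periodic distributions $f$ with Fourier coefficients $\widehat f(n)$, $n\in\mathbb Z$, and finite norm $\|f\|_\beta=\big(\sum_{n\in\mathbb Z}\langle n\rangle^{2\beta}|\widehat f(n)|^2\big)^{1/2}$. Let $H^\beta_{c,0}=\{u\in H^\beta_c: \widehat u(0)=0\}$ and $H^\beta_+=\{f\in H^\beta_c: \widehat f(n)=0\ \forall n<0\}$. For $f\in H^\beta_c$, $g\in H^{-\beta}_c$ put $\langle f|g\rangle=\sum_{n\in\mathbb Z}\widehat f(n)\overline{\widehat g(n)}$. Let $\ell^1_+=\ell^1(\mathbb Z_{\ge1},\mathbb C)$. Let $-1/2<s\le 0$. For $u\in H^s_{c}$ the Lax operator of the Benjamin–Ono equation is the bounded operator $$L_u=D-T_u:\ H^{1+s}_+\to H^s_+,\qquad D=-i\partial_x,\quad T_uf=\Pi(uf),$$ where $\Pi$ is the Szegő projector $\sum_{n\in\mathbb Z}\widehat v(n)e^{inx}\mapsto\sum_{n\ge0}\widehat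 v(n)e^{inx}$. Let $S:H^{1+s}_+\to H^{1+s}_+$, $Sf=e^{ix}f$. For $n\ge 0$ let $$P_n=P_n(u)=-\frac1{2\pi i}\oint_{|\lambda-n|=1/3}(L_u-\lambda)^{-1}\,d\lambda\ \in\ \mathcal L(H^s_+,H^{1+s}_+)$$ (counterclockwise contour), which is well defined whenever $L_u-\lambda:H^{1+s}_+\to H^s_+$ is invertible with bounded inverse for all $\lambda$ with $|\lambda-n|=1/3$. For $n\ge1$ let $$\delta_n(u)=\big\langle P_nSP_{n-1}e_{n-1}\,\big|\,e_n\big\rangle-\big\langle P_ne_n\,\big|\,e_n\big\rangle .$$ **Proposition.** For any $-1/2<s\le0$ there exists an open neighborhood $U^s$ of zero in $H^s_{c,0}$ such that for every $u\in U^s$ all the Riesz projectors $P_n(u)$, $n\ge0$, are well defined in the above sense, the sequence $(\delta_n(u))_{n\ge1}$ belongs to $\ell^1_+$, and the map $$\delta:U^s\to\ell^1_+,\qquad u\mapsto(\delta_n(u))_{n\ge1},$$ is (complex) analytic and bounded. -/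

import Mathlib

noncomputable section

namespace BenjaminOno

/-! ### Sobolev spaces on the torus

A periodic distribution `u` on `𝕋 = ℝ / 2πℤ` is represented by the sequence
`n ↦ û(n)` of its Fourier coefficients, so that `H^β(𝕋, ℂ)` is the space of all sequences `û : ℤ → ℂ`
with `∑ ⟨n⟩^{2β} |û(n)|² < ∞`. -/

/-- The weight `⟨n⟩ = max {1, |n|}`. -/
def jap (n : ℤ) : ℝ := max 1 |(n : ℝ)|

theorem one_le_jap (n : ℤ) : 1 ≤ jap n := le_max_left _ _

theorem jap_pos (n : ℤ) : 0 < jap n := lt_of_lt_of_le one_pos (one_le_jap n)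

theorem abs_le_jap (n : ℤ) : |(n : ℝ)| ≤ jap n := le_max_right _ _

theorem jap_add_le (m n : ℤ) : jap (m + n) ≤ jap m + jap n := by
  refine max_le ?_ ?_
  · linarith [one_le_jap m, one_le_jap n]
  · push_cast
    exact (abs_add_le _ _).trans (add_le_add (abs_le_jap m) (abs_le_jap n))

theorem jap_neg (n : ℤ) : jap (-n) = jap n := by simp [jap]

/-- The weighted coefficients `⟨n⟩^β û(n)`. -/
def weighted (β : ℝ) : (ℤ → ℂ) →ₗ[ℂ] (ℤ → ℂ) where
  toFun f n := ((jap n ^ β : ℝ) : ℂ) * f n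
  map_add' f g := by ext n; simp [mul_add]
  map_smul' c f := by ext n; simp; ring

theorem norm_weighted_sq (β : ℝ) (f : ℤ → ℂ) (n : ℤ) :
    ‖weighted β f n‖ ^ 2 = jap n ^ (2 * β) * ‖f n‖ ^ 2 := by
  have h : (0 : ℝ) ≤ jap n ^ β := Real.rpow_nonneg (jap_pos n).le _
  have h2 : jap n ^ (2 * β) = (jap n ^ β) ^ 2 := by
    rw [mul_comm, Real.rpow_mul (jap_pos n).le, Real.rpow_two]
  simp only [weighted, LinearMap.coe_mk, AddHom.coe_mk, norm_mul, Complex.norm_real,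
    Real.norm_of_nonneg h, h2, mul_pow]

theorem memlp_weighted_iff (β : ℝ) (f : ℤ → ℂ) :
    Memℓp (E := fun _ : ℤ => ℂ) (weighted β f) 2 ↔
      Summable fun n : ℤ => jap n ^ (2 * β) * ‖f n‖ ^ 2 := by
  rw [memℓp_gen_iff (by norm_num)]
  simp [norm_weighted_sq]

/-- The sequences of Fourier coefficients of the elements of `H^β(𝕋, ℂ)`. -/
def sobolevSubmodule (β : ℝ) : Submodule ℂ (ℤ → ℂ) where
  carrier := {f | Summable fun n : ℤ => jap n ^ (2 * β) * ‖f n‖ ^ 2}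
  add_mem' {f g} hf hg := by
    simp only [Set.mem_ofPred_eq, ← memlp_weighted_iff] at hf hg ⊢
    rw [map_add]
    exact hf.add hg
  zero_mem' := by simp
  smul_mem' c f hf := by
    simp only [Set.mem_ofPred_eq, ← memlp_weighted_iff] at hf ⊢
    rw [map_smul]
    exact hf.const_smul c

/-- The Sobolev space `H^β_c = H^β(𝕋, ℂ)`, for an arbitrary regularity exponent `β`. -/
def Sobolev (β : ℝ) : Type := ↥(sobolevSubmodule β)

namespace Sobolev

variable {β : ℝ}

instance : AddCommGroup (Sobolev β) := inferInstanceAs (AddCommGroup ↥(sobolevSubmodule β))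

instance : Module ℂ (Sobolev β) := inferInstanceAs (Module ℂ ↥(sobolevSubmodule β))

/-- The sequence of Fourier coefficients `n ↦ û(n)`. -/
def coeff (f : Sobolev β) : ℤ → ℂ := f.1

/-- The element of `H^β_c` with prescribed Fourier coefficients. -/
def mk (f : ℤ → ℂ) (hf : Summable fun n : ℤ => jap n ^ (2 * β) * ‖f n‖ ^ 2) : Sobolev β := ⟨f, hf⟩

theorem ext {f g : Sobolev β} (h : ∀ n, f.coeff n = g.coeff n) : f = g :=
  Subtype.ext (funext h)

@[simp] theorem coeff_mk (f : ℤ → ℂ) (hf) : (mk (β := β) f hf).coeff = f := rfl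

@[simp] theorem coeff_add (f g : Sobolev β) : (f + g).coeff = f.coeff + g.coeff := rfl

@[simp] theorem coeff_smul (c : ℂ) (f : Sobolev β) : (c • f).coeff = c • f.coeff := rfl

@[simp] theorem coeff_zero : (0 : Sobolev β).coeff = 0 := rfl

theorem summable (f : Sobolev β) : Summable fun n : ℤ => jap n ^ (2 * β) * ‖f.coeff n‖ ^ 2 := f.2

/-- `‖f‖_β = (∑ ⟨n⟩^{2β} |f̂(n)|²)^{1/2}`. -/
instance : Norm (Sobolev β) where
  norm f := √(∑' n : ℤ, jap n ^ (2 * β) * ‖f.coeff n‖ ^ 2)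

theorem norm_def (f : Sobolev β) :
    ‖f‖ = √(∑' n : ℤ, jap n ^ (2 * β) * ‖f.coeff n‖ ^ 2) := rfl

theorem term_nonneg (f : ℤ → ℂ) (n : ℤ) : 0 ≤ jap n ^ (2 * β) * ‖f n‖ ^ 2 :=
  mul_nonneg (Real.rpow_nonneg (jap_pos n).le _) (sq_nonneg _)

theorem norm_sq (f : Sobolev β) :
    ‖f‖ ^ 2 = ∑' n : ℤ, jap n ^ (2 * β) * ‖f.coeff n‖ ^ 2 := by
  rw [norm_def, Real.sq_sqrt (tsum_nonneg (term_nonneg _))]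

/-- The map `f ↦ (⟨n⟩^β f̂(n))_n` onto `ℓ²(ℤ)`. -/
def toL2 (β : ℝ) : Sobolev β →ₗ[ℂ] lp (fun _ : ℤ => ℂ) 2 where
  toFun f := ⟨weighted β f.coeff, (memlp_weighted_iff β f.coeff).2 f.summable⟩
  map_add' f g := by ext n; simp; rfl
  map_smul' c f := by ext n; simp

theorem norm_toL2 (f : Sobolev β) : ‖toL2 β f‖ = ‖f‖ := by
  rw [lp.norm_eq_tsum_rpow (by norm_num), norm_def, Real.sqrt_eq_rpow]
  simp [toL2, norm_weighted_sq]

theorem toL2_injective : Function.Injective (toL2 β) := by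
  intro f g h
  refine ext fun n => ?_
  have h1 : weighted β f.coeff n = weighted β g.coeff n := congrArg (fun x => x.1 n) h
  have h2 : ((jap n ^ β : ℝ) : ℂ) ≠ 0 := by
    exact_mod_cast (Real.rpow_pos_of_pos (jap_pos n) β).ne'
  exact mul_left_cancel₀ h2 h1

theorem core : NormedSpace.Core ℂ (Sobolev β) where
  norm_nonneg f := Real.sqrt_nonneg _
  norm_smul c f := by simp [← norm_toL2, map_smul, norm_smul]
  norm_triangle f g := by simpa [← norm_toL2] using norm_add_le _ _
  norm_eq_zero_iff f := by
    rw [← norm_toL2, norm_eq_zero]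
    exact map_eq_zero_iff _ toL2_injective

instance : NormedAddCommGroup (Sobolev β) := NormedAddCommGroup.ofCore core

instance : NormedSpace ℂ (Sobolev β) := NormedSpace.ofCore core

instance : CompleteSpace (Sobolev β) := by
  have hs : Function.Surjective (toL2 β) := by
    intro g
    have hg : weighted β (fun n => ((jap n ^ β : ℝ) : ℂ)⁻¹ * g n) = g := by
      funext n
      have h2 : ((jap n ^ β : ℝ) : ℂ) ≠ 0 := by
        exact_mod_cast (Real.rpow_pos_of_pos (jap_pos n) β).ne'
      simp only [weighted, LinearMap.coe_mk, AddHom.coe_mk]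
      rw [mul_inv_cancel_left₀ h2]
    refine ⟨mk (fun n => ((jap n ^ β : ℝ) : ℂ)⁻¹ * g n)
      ((memlp_weighted_iff β _).1 (by rw [hg]; exact lp.memℓp g)), ?_⟩
    ext n
    exact congrFun hg n
  let e : Sobolev β ≃ₗᵢ[ℂ] lp (fun _ : ℤ => ℂ) 2 :=
    { LinearEquiv.ofBijective (toL2 β) ⟨toL2_injective, hs⟩ with norm_map' := norm_toL2 }
  exact (completeSpace_congr (e := e.toLinearEquiv.toEquiv) e.isometry.isUniformEmbedding).2
    inferInstance

theorem norm_coeff_le (f : Sobolev β) (n : ℤ) : ‖f.coeff n‖ ≤ jap n ^ (-β) * ‖f‖ := by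
  have h := lp.norm_apply_le_norm (by norm_num) (toL2 β f) n
  rw [norm_toL2] at h
  have h0 := Real.rpow_pos_of_pos (jap_pos n) β
  have h1 : ‖toL2 β f n‖ = jap n ^ β * ‖f.coeff n‖ := by
    simp [toL2, weighted, abs_of_pos h0]
  rw [h1] at h
  rw [Real.rpow_neg (jap_pos n).le, inv_mul_eq_div, le_div_iff₀ h0]
  linarith

/-- The `n`-th Fourier coefficient as a bounded linear functional. -/
def coeffCLM (β : ℝ) (n : ℤ) : Sobolev β →L[ℂ] ℂ :=
  LinearMap.mkContinuous
    { toFun := fun f => f.coeff n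
      map_add' := fun _ _ => rfl
      map_smul' := fun _ _ => rfl } (jap n ^ (-β)) fun f => norm_coeff_le f n

end Sobolev

/-- `H^β_{c,0}`: the elements of `H^β_c` with mean value zero. -/
def SobolevZero (β : ℝ) : Submodule ℂ (Sobolev β) where
  carrier := {u | u.coeff 0 = 0}
  add_mem' {f g} hf hg := by simp_all
  zero_mem' := by simp
  smul_mem' c f hf := by simp_all

/-- The Hardy space `H^β_+`: the elements of `H^β_c` whose negative Fourier coefficients vanish. -/
def Hardy (β : ℝ) : Submodule ℂ (Sobolev β) where
  carrier := {f | ∀ n < 0, f.coeff n = 0}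
  add_mem' {f g} hf hg n hn := by simp [hf n hn, hg n hn]
  zero_mem' n hn := by simp
  smul_mem' c f hf n hn := by simp [hf n hn]

theorem isClosed_hardy (β : ℝ) : IsClosed (Hardy β : Set (Sobolev β)) := by
  have : (Hardy β : Set (Sobolev β)) = ⋂ n : ℤ, ⋂ _ : n < 0, {f | Sobolev.coeffCLM β n f = 0} := by
    ext f
    simp only [Set.mem_iInter]
    exact Iff.rfl
  rw [this]
  exact isClosed_iInter fun n => isClosed_iInter fun _ =>
    isClosed_eq (Sobolev.coeffCLM β n).continuous continuous_const

instance (β : ℝ) : CompleteSpace (Hardy β) := (isClosed_hardy β).completeSpace_coe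

theorem isClosed_sobolevZero (β : ℝ) : IsClosed (SobolevZero β : Set (Sobolev β)) :=
  isClosed_eq (Sobolev.coeffCLM β 0).continuous continuous_const

instance (β : ℝ) : CompleteSpace (SobolevZero β) := (isClosed_sobolevZero β).completeSpace_coe

/-- The sesquilinear pairing `⟨f | g⟩ = ∑ f̂(n) conj(ĝ(n))` of `f ∈ H^β_c` and `g ∈ H^{-β}_c`. -/
def pairing {β : ℝ} (f : Sobolev β) (g : Sobolev (-β)) : ℂ :=
  ∑' n : ℤ, f.coeff n * starRingEnd ℂ (g.coeff n)

theorem Sobolev.summable_single (β : ℝ) (n : ℤ) :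
    Summable fun k : ℤ => jap k ^ (2 * β) * ‖(Pi.single n 1 : ℤ → ℂ) k‖ ^ 2 := by
  refine summable_of_ne_finset_zero (s := {n}) fun k hk => ?_
  simp only [Finset.mem_singleton] at hk
  simp [hk]

/-- `e_n = e^{inx}`, `n ≥ 0`, as an element of the Hardy space `H^β_+` (for any `β`). -/
def expo (β : ℝ) (n : ℕ) : Hardy β :=
  ⟨Sobolev.mk (Pi.single (n : ℤ) 1) (Sobolev.summable_single β n), fun k hk => by
    have : k ≠ (n : ℤ) := by omega
    simp [this]⟩

/-! ### The operators `ι`, `D`, `S`, `T_u` and `L_u` -/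

/-- A linear map between Hardy spaces, given on Fourier coefficients by `A` and bounded with
constant `C`. -/
def hardyOp {β γ : ℝ} (A : Hardy β →ₗ[ℂ] (ℤ → ℂ)) (C : ℝ) (hC : 0 ≤ C)
    (hneg : ∀ f, ∀ n < 0, A f n = 0)
    (hsum : ∀ f, Summable fun n : ℤ => jap n ^ (2 * γ) * ‖A f n‖ ^ 2)
    (hbound : ∀ f : Hardy β, ∑' n : ℤ, jap n ^ (2 * γ) * ‖A f n‖ ^ 2 ≤ C ^ 2 * ‖f‖ ^ 2) :
    Hardy β →L[ℂ] Hardy γ :=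
  LinearMap.mkContinuous
    { toFun := fun f => ⟨Sobolev.mk (A f) (hsum f), hneg f⟩
      map_add' := fun f g => Subtype.ext (Sobolev.ext fun n => by simp)
      map_smul' := fun c f => Subtype.ext (Sobolev.ext fun n => by simp) } C fun f => by
    refine abs_le_of_sq_le_sq' ?_ (by positivity) |>.2
    rw [mul_pow]
    refine le_trans (le_of_eq ?_) (hbound f)
    exact Sobolev.norm_sq _

@[simp] theorem hardyOp_coeff {β γ : ℝ} (A : Hardy β →ₗ[ℂ] (ℤ → ℂ)) (C : ℝ) (hC hneg hsum hbound)
    (f : Hardy β) : ((hardyOp (γ := γ) A C hC hneg hsum hbound f : Hardy γ) : Sobolev γ).coeff = A f :=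
  rfl

/-- Comparison of a coefficientwise bounded operator with the norm of the argument. -/
theorem summable_tsum_le {β γ : ℝ} (f : Sobolev β) (g : ℤ → ℂ)
    (h : ∀ n, jap n ^ (2 * γ) * ‖g n‖ ^ 2 ≤ jap n ^ (2 * β) * ‖f.coeff n‖ ^ 2) :
    Summable (fun n : ℤ => jap n ^ (2 * γ) * ‖g n‖ ^ 2) ∧
      ∑' n : ℤ, jap n ^ (2 * γ) * ‖g n‖ ^ 2 ≤ (1 : ℝ) ^ 2 * ‖f‖ ^ 2 := by
  have hs := Summable.of_nonneg_of_le (Sobolev.term_nonneg g) h f.summable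
  refine ⟨hs, ?_⟩
  rw [one_pow, one_mul, Sobolev.norm_sq]
  exact hs.tsum_le_tsum h f.summable

theorem incl_le (s : ℝ) (f : Sobolev (1 + s)) (n : ℤ) :
    jap n ^ (2 * s) * ‖f.coeff n‖ ^ 2 ≤ jap n ^ (2 * (1 + s)) * ‖f.coeff n‖ ^ 2 :=
  mul_le_mul_of_nonneg_right
    (Real.rpow_le_rpow_of_exponent_le (one_le_jap n) (by linarith)) (sq_nonneg _)

/-- The inclusion `H^{1+s}_+ → H^s_+`. -/
def incl (s : ℝ) : Hardy (1 + s) →L[ℂ] Hardy s :=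
  hardyOp
    { toFun := fun f => (f : Sobolev (1 + s)).coeff
      map_add' := fun _ _ => rfl
      map_smul' := fun _ _ => rfl } 1 zero_le_one
    (fun f n hn => f.2 n hn)
    (fun f => (summable_tsum_le f.1 _ (incl_le s f.1)).1)
    (fun f => (summable_tsum_le f.1 _ (incl_le s f.1)).2)

theorem deriv_le (s : ℝ) (f : Sobolev (1 + s)) (n : ℤ) :
    jap n ^ (2 * s) * ‖(n : ℂ) * f.coeff n‖ ^ 2 ≤ jap n ^ (2 * (1 + s)) * ‖f.coeff n‖ ^ 2 := by
  have h1 : jap n ^ (2 * (1 + s)) = jap n ^ (2 * s) * jap n ^ 2 := by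
    rw [show 2 * (1 + s) = 2 * s + 2 by ring, Real.rpow_add (jap_pos n), Real.rpow_two]
  have h2 : ‖(n : ℂ)‖ ^ 2 ≤ jap n ^ 2 := by
    rw [Complex.norm_intCast]
    exact pow_le_pow_left₀ (abs_nonneg _) (abs_le_jap n) 2
  rw [h1, norm_mul, mul_pow, mul_assoc]
  have := Real.rpow_nonneg (jap_pos n).le (2 * s)
  gcongr

/-- `D = -i ∂_x : H^{1+s}_+ → H^s_+`, the Fourier multiplier with symbol `n`. -/
def derivOp (s : ℝ) : Hardy (1 + s) →L[ℂ] Hardy s :=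
  hardyOp
    { toFun := fun f n => (n : ℂ) * (f : Sobolev (1 + s)).coeff n
      map_add' := fun f g => by ext n; simp [mul_add]
      map_smul' := fun c f => by ext n; simp; ring } 1 zero_le_one
    (fun f n hn => by
      have := f.2 n hn
      simp [this])
    (fun f => (summable_tsum_le f.1 _ (deriv_le s f.1)).1)
    (fun f => (summable_tsum_le f.1 _ (deriv_le s f.1)).2)

theorem jap_rpow_shift_le (a : ℝ) (n : ℤ) : jap (n + 1) ^ a ≤ 2 ^ |a| * jap n ^ a := by
  have hj : jap 1 = 1 := by simp [jap]
  have hj' : jap (-1) = 1 := by simp [jap]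
  have h1 : jap (n + 1) ≤ 2 * jap n := by
    have := jap_add_le n 1
    linarith [one_le_jap n]
  have h2 : jap n ≤ 2 * jap (n + 1) := by
    have := jap_add_le (n + 1) (-1)
    rw [add_neg_cancel_right] at this
    linarith [one_le_jap (n + 1)]
  have p1 := jap_pos n
  have p2 := jap_pos (n + 1)
  rcases le_total 0 a with ha | ha
  · rw [abs_of_nonneg ha, ← Real.mul_rpow (by norm_num) p1.le]
    exact Real.rpow_le_rpow p2.le h1 ha
  · rw [abs_of_nonpos ha, Real.rpow_neg (by norm_num), ← Real.inv_rpow (by norm_num),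
      ← Real.mul_rpow (by norm_num) p1.le]
    exact Real.rpow_le_rpow_of_nonpos (by positivity) (by linarith) ha

theorem shift_bound (β : ℝ) (f : Sobolev β) :
    Summable (fun n : ℤ => jap n ^ (2 * β) * ‖f.coeff (n - 1)‖ ^ 2) ∧
      ∑' n : ℤ, jap n ^ (2 * β) * ‖f.coeff (n - 1)‖ ^ 2 ≤ (2 ^ |β|) ^ 2 * ‖f‖ ^ 2 := by
  have e1 : ((2 : ℝ) ^ |β|) ^ 2 = 2 ^ |2 * β| := by
    rw [← Real.rpow_two, ← Real.rpow_mul (by norm_num), abs_mul]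
    norm_num [mul_comm]
  have hF := (f.summable.mul_left ((2 : ℝ) ^ |2 * β|))
  have hF' := (Equiv.subRight (1 : ℤ)).summable_iff.2 hF
  have hle : ∀ n : ℤ, jap n ^ (2 * β) * ‖f.coeff (n - 1)‖ ^ 2 ≤
      ((fun n : ℤ => (2 : ℝ) ^ |2 * β| * (jap n ^ (2 * β) * ‖f.coeff n‖ ^ 2)) ∘
        Equiv.subRight (1 : ℤ)) n := by
    intro n
    have := jap_rpow_shift_le (2 * β) (n - 1)
    rw [sub_add_cancel] at this
    simp only [Function.comp, Equiv.subRight_apply, ← mul_assoc]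
    exact mul_le_mul_of_nonneg_right this (sq_nonneg _)
  have hs := Summable.of_nonneg_of_le (fun n => mul_nonneg (Real.rpow_nonneg (jap_pos n).le _)
    (sq_nonneg _)) hle hF'
  refine ⟨hs, (hs.tsum_le_tsum hle hF').trans (le_of_eq ?_)⟩
  rw [e1, Sobolev.norm_sq, ← tsum_mul_left]
  exact (Equiv.subRight (1 : ℤ)).tsum_eq
    (fun n : ℤ => (2 : ℝ) ^ |2 * β| * (jap n ^ (2 * β) * ‖f.coeff n‖ ^ 2))

/-- The shift operator `S : H^β_+ → H^β_+`, `f ↦ e^{ix} f`. -/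
def shift (β : ℝ) : Hardy β →L[ℂ] Hardy β :=
  hardyOp
    { toFun := fun f n => (f : Sobolev β).coeff (n - 1)
      map_add' := fun _ _ => rfl
      map_smul' := fun _ _ => rfl } (2 ^ |β|) (by positivity)
    (fun f n hn => f.2 (n - 1) (by omega))
    (fun f => (shift_bound β f.1).1)
    (fun f => (shift_bound β f.1).2)

/-! #### The product `u f` for `u ∈ H^s_c` and `f ∈ H^{1+s}_c` -/

/-- The Fourier coefficients `∑_k û(n - k) f̂(k)` of the product `u f`. -/
def mulCoeff {β γ : ℝ} (u : Sobolev β) (f : Sobolev γ) (n : ℤ) : ℂ :=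
  ∑' k : ℤ, u.coeff (n - k) * f.coeff k

theorem summable_jap_rpow {b : ℝ} (hb : b < -1) : Summable fun n : ℤ => jap n ^ b := by
  have h := Real.summable_abs_int_rpow (b := -b) (by linarith)
  refine (summable_congr_cofinite ?_).1 h
  have hfin : ({0} : Set ℤ)ᶜ ∈ Filter.cofinite := (Set.finite_singleton 0).compl_mem_cofinite
  filter_upwards [hfin] with n hn
  have hn' : (1 : ℝ) ≤ |(n : ℝ)| := by
    exact_mod_cast Int.one_le_abs hn
  rw [neg_neg, jap, max_eq_right hn']

/-- The constant in the product estimate. -/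
def prodConst (s : ℝ) : ℝ := 4 * ∑' k : ℤ, jap k ^ (-2 - 2 * s)

theorem prodConst_nonneg (s : ℝ) : 0 ≤ prodConst s :=
  mul_nonneg (by norm_num) (tsum_nonneg fun k => Real.rpow_nonneg (jap_pos k).le _)

theorem weight_le {s : ℝ} (hs : -1 / 2 < s) (hs' : s ≤ 0) {p q r : ℝ} (hp : 1 ≤ p) (hq : 1 ≤ q)
    (hr : 1 ≤ r) (hrpq : r ≤ p + q) :
    p ^ (2 * s) * r ^ (-(2 * s)) * q ^ (-2 - 2 * s) ≤
      2 * (p ^ (-2 - 2 * s) + q ^ (-2 - 2 * s)) := by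
  have hp0 : 0 < p := by linarith
  have hq0 : 0 < q := by linarith
  have hr0 : 0 < r := by linarith
  have two_le : (2 : ℝ) ^ (-(2 * s)) ≤ 2 := by
    calc (2 : ℝ) ^ (-(2 * s)) ≤ 2 ^ (1 : ℝ) :=
          Real.rpow_le_rpow_of_exponent_le (by norm_num) (by linarith)
      _ = 2 := Real.rpow_one 2
  have key : ∀ x : ℝ, 0 < x → r ≤ 2 * x → r ^ (-(2 * s)) ≤ 2 * x ^ (-(2 * s)) := by
    intro x hx hrx
    calc r ^ (-(2 * s)) ≤ (2 * x) ^ (-(2 * s)) := Real.rpow_le_rpow hr0.le hrx (by linarith)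
      _ = 2 ^ (-(2 * s)) * x ^ (-(2 * s)) := Real.mul_rpow (by norm_num) hx.le
      _ ≤ 2 * x ^ (-(2 * s)) := mul_le_mul_of_nonneg_right two_le (Real.rpow_nonneg hx.le _)
  have P1 := Real.rpow_pos_of_pos hp0 (-2 - 2 * s)
  have Q1 := Real.rpow_pos_of_pos hq0 (-2 - 2 * s)
  have P2 := Real.rpow_pos_of_pos hp0 (2 * s)
  rcases le_total p q with h | h
  · calc p ^ (2 * s) * r ^ (-(2 * s)) * q ^ (-2 - 2 * s)
        ≤ p ^ (2 * s) * (2 * q ^ (-(2 * s))) * q ^ (-2 - 2 * s) := by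
          have := key q hq0 (by linarith)
          gcongr
      _ = 2 * (p ^ (2 * s) * q ^ (-2 - 4 * s)) := by
          rw [show -2 - 4 * s = -(2 * s) + (-2 - 2 * s) by ring, Real.rpow_add hq0]; ring
      _ ≤ 2 * (p ^ (2 * s) * p ^ (-2 - 4 * s)) := by
          have := Real.rpow_le_rpow_of_nonpos hp0 h (show -2 - 4 * s ≤ 0 by linarith)
          gcongr
      _ = 2 * p ^ (-2 - 2 * s) := by
          rw [← Real.rpow_add hp0]; ring_nf
      _ ≤ _ := by linarith
  · calc p ^ (2 * s) * r ^ (-(2 * s)) * q ^ (-2 - 2 * s)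
        ≤ p ^ (2 * s) * (2 * p ^ (-(2 * s))) * q ^ (-2 - 2 * s) := by
          have := key p hp0 (by linarith)
          gcongr
      _ = 2 * q ^ (-2 - 2 * s) * (p ^ (2 * s) * p ^ (-(2 * s))) := by ring
      _ = 2 * q ^ (-2 - 2 * s) := by rw [← Real.rpow_add hp0]; simp
      _ ≤ _ := by linarith

/-- For `j` fixed, the weights `⟨j+k⟩^{2s} ⟨j⟩^{-2s} ⟨k⟩^{-2-2s}` are summable in `k`, with a bound
independent of `j`. -/
theorem weight_sum {s : ℝ} (hs : -1 / 2 < s) (hs' : s ≤ 0) (j : ℤ) :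
    Summable (fun k : ℤ => jap (j + k) ^ (2 * s) * jap j ^ (-(2 * s)) * jap k ^ (-2 - 2 * s)) ∧
      ∑' k : ℤ, jap (j + k) ^ (2 * s) * jap j ^ (-(2 * s)) * jap k ^ (-2 - 2 * s) ≤
        prodConst s := by
  have hS : Summable fun k : ℤ => jap k ^ (-2 - 2 * s) := summable_jap_rpow (by linarith)
  have hS' : Summable fun k : ℤ => jap (j + k) ^ (-2 - 2 * s) :=
    (Equiv.addLeft j).summable_iff.2 hS
  have hle : ∀ k : ℤ, jap (j + k) ^ (2 * s) * jap j ^ (-(2 * s)) * jap k ^ (-2 - 2 * s) ≤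
      2 * (jap (j + k) ^ (-2 - 2 * s) + jap k ^ (-2 - 2 * s)) := by
    intro k
    refine weight_le hs hs' (one_le_jap _) (one_le_jap _) (one_le_jap _) ?_
    have := jap_add_le (j + k) (-k)
    rwa [add_neg_cancel_right, jap_neg] at this
  have hR := (hS'.add hS).mul_left 2
  have hsum := Summable.of_nonneg_of_le (fun k => by
    have := jap_pos (j + k); have := jap_pos j; have := jap_pos k; positivity) hle hR
  refine ⟨hsum, (hsum.tsum_le_tsum hle hR).trans (le_of_eq ?_)⟩
  have he : ∑' k : ℤ, jap (j + k) ^ (-2 - 2 * s) = ∑' k : ℤ, jap k ^ (-2 - 2 * s) :=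
    (Equiv.addLeft j).tsum_eq (fun k : ℤ => jap k ^ (-2 - 2 * s))
  rw [tsum_mul_left, hS'.tsum_add hS, he, prodConst]
  ring

theorem cauchy_schwarz_tsum {a b : ℤ → ℝ} (ha : ∀ k, 0 ≤ a k) (hb : ∀ k, 0 ≤ b k)
    (hA : Summable fun k => a k ^ 2) (hB : Summable fun k => b k ^ 2) :
    (Summable fun k => a k * b k) ∧
      (∑' k, a k * b k) ^ 2 ≤ (∑' k, a k ^ 2) * ∑' k, b k ^ 2 := by
  have h := Real.summable_and_inner_le_Lp_mul_Lq_tsum_of_nonneg Real.HolderConjugate.two_two ha hb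
    (by simpa using hA) (by simpa using hB)
  refine ⟨h.1, ?_⟩
  have h2 := h.2
  simp only [Real.rpow_two, ← Real.sqrt_eq_rpow] at h2
  have h0 : 0 ≤ ∑' k, a k * b k := tsum_nonneg fun k => mul_nonneg (ha k) (hb k)
  calc (∑' k, a k * b k) ^ 2 ≤ (√(∑' k, a k ^ 2) * √(∑' k, b k ^ 2)) ^ 2 :=
        pow_le_pow_left₀ h0 h2 2
    _ = _ := by
        rw [mul_pow, Real.sq_sqrt (tsum_nonneg fun k => sq_nonneg _),
          Real.sq_sqrt (tsum_nonneg fun k => sq_nonneg _)]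

/-- The product `u f` of `u ∈ H^s_c` and `f ∈ H^{1+s}_c`, `-1/2 < s ≤ 0`: its Fourier coefficients
are given by absolutely convergent series, and it belongs to `H^s_c`. -/
theorem mul_bound {s : ℝ} (hs : -1 / 2 < s) (hs' : s ≤ 0) (u : Sobolev s) (f : Sobolev (1 + s)) :
    (∀ n : ℤ, Summable fun k : ℤ => u.coeff (n - k) * f.coeff k) ∧
      Summable (fun n : ℤ => jap n ^ (2 * s) * ‖mulCoeff u f n‖ ^ 2) ∧
      ∑' n : ℤ, jap n ^ (2 * s) * ‖mulCoeff u f n‖ ^ 2 ≤ prodConst s * ‖u‖ ^ 2 * ‖f‖ ^ 2 := by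
  set y : ℤ → ℝ := fun j => jap j ^ (2 * s) * ‖u.coeff j‖ ^ 2 with hy
  have hy0 : ∀ j, 0 ≤ y j := Sobolev.term_nonneg _
  set W : ℤ → ℤ → ℝ := fun j k =>
    jap (j + k) ^ (2 * s) * jap j ^ (-(2 * s)) * jap k ^ (-2 - 2 * s) with hW
  have hW0 : ∀ j k, 0 ≤ W j k := fun j k => by
    have := jap_pos (j + k); have := jap_pos j; have := jap_pos k
    simp only [hW]; positivity
  set F : ℤ × ℤ → ℝ := fun q => y q.1 * W q.1 q.2 with hF
  have hF0 : 0 ≤ F := fun q => mul_nonneg (hy0 _) (hW0 _ _)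
  have hrow : ∀ j, ∑' k, F (j, k) ≤ prodConst s * y j := fun j => by
    simp only [hF]
    rw [tsum_mul_left, mul_comm]
    exact mul_le_mul_of_nonneg_right (weight_sum hs hs' j).2 (hy0 j)
  have hyc : Summable fun j => prodConst s * y j := u.summable.mul_left (prodConst s)
  have hFs : Summable F := by
    refine (summable_prod_of_nonneg hF0).2 ⟨fun j => (weight_sum hs hs' j).1.mul_left (y j), ?_⟩
    exact Summable.of_nonneg_of_le (fun j => tsum_nonneg fun k => hF0 (j, k)) hrow hyc
  have hFt : ∑' q, F q ≤ prodConst s * ‖u‖ ^ 2 := by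
    have h1 : ∑' q, F q = ∑' j, ∑' k, F (j, k) := hFs.tsum_prod
    have h2 : ∑' j, ∑' k, F (j, k) ≤ ∑' j, prodConst s * y j :=
      hFs.prod.tsum_le_tsum hrow hyc
    have h3 : ∑' j, prodConst s * y j = prodConst s * ‖u‖ ^ 2 := by
      rw [tsum_mul_left, Sobolev.norm_sq]
    exact h1.trans_le (h2.trans h3.le)
  let e : ℤ × ℤ ≃ ℤ × ℤ :=
    { toFun := fun q => (q.1 - q.2, q.2)
      invFun := fun q => (q.1 + q.2, q.2)
      left_inv := fun q => by simp
      right_inv := fun q => by simp }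
  have hGs : Summable (F ∘ e) := e.summable_iff.2 hFs
  have hGt : ∑' q, (F ∘ e) q ≤ prodConst s * ‖u‖ ^ 2 := by
    have : ∑' q, (F ∘ e) q = ∑' q, F q := e.tsum_eq F
    rw [this]; exact hFt
  -- the two factors in the Cauchy-Schwarz inequality
  set a : ℤ → ℝ := fun k => jap k ^ (1 + s) * ‖f.coeff k‖ with ha
  set b : ℤ → ℤ → ℝ := fun n k =>
    jap n ^ s * jap k ^ (-(1 + s)) * ‖u.coeff (n - k)‖ with hb
  have ha0 : ∀ k, 0 ≤ a k := fun k => by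
    have := jap_pos k
    simp only [ha]; positivity
  have hb0 : ∀ n k, 0 ≤ b n k := fun n k => by
    have := jap_pos n; have := jap_pos k
    simp only [hb]; positivity
  have dbl : ∀ (m : ℤ) (c : ℝ), (jap m ^ c) ^ 2 = jap m ^ (2 * c) := fun m c => by
    rw [mul_comm, Real.rpow_mul (jap_pos m).le, Real.rpow_two]
  have ha2 : ∀ k, a k ^ 2 = jap k ^ (2 * (1 + s)) * ‖f.coeff k‖ ^ 2 := fun k => by
    simp only [ha, mul_pow, dbl]
  have hb2 : ∀ n k, b n k ^ 2 = (F ∘ e) (n, k) := fun n k => by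
    have h1 : jap (n - k) ^ (-(2 * s)) * jap (n - k) ^ (2 * s) = 1 := by
      rw [← Real.rpow_add (jap_pos _)]; simp
    simp only [hb, hF, hy, hW, e, Function.comp, Equiv.coe_fn_mk, mul_pow, dbl, sub_add_cancel]
    rw [show 2 * -(1 + s) = -2 - 2 * s by ring]
    linear_combination (-(jap n ^ (2 * s) * jap k ^ (-2 - 2 * s) * ‖u.coeff (n - k)‖ ^ 2)) * h1
  have hab : ∀ n k, a k * b n k = jap n ^ s * ‖u.coeff (n - k) * f.coeff k‖ := fun n k => by
    have h1 : jap k ^ (1 + s) * jap k ^ (-(1 + s)) = 1 := by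
      rw [← Real.rpow_add (jap_pos _)]; simp
    simp only [ha, hb, norm_mul]
    linear_combination (jap n ^ s * ‖u.coeff (n - k)‖ * ‖f.coeff k‖) * h1
  have hA : Summable fun k => a k ^ 2 := by simp only [ha2]; exact f.summable
  have hB : ∀ n, Summable fun k => b n k ^ 2 := fun n => by
    simp only [hb2]; exact hGs.prod_factor n
  have CS := fun n => cauchy_schwarz_tsum ha0 (hb0 n) hA (hB n)
  have hsn : ∀ n : ℤ, Summable fun k : ℤ => ‖u.coeff (n - k) * f.coeff k‖ := fun n => by
    have h := (CS n).1
    simp only [hab] at h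
    exact (summable_mul_left_iff (Real.rpow_pos_of_pos (jap_pos n) s).ne').1 h
  have hle : ∀ n : ℤ, jap n ^ (2 * s) * ‖mulCoeff u f n‖ ^ 2 ≤
      ‖f‖ ^ 2 * ∑' k, (F ∘ e) (n, k) := fun n => by
    have h := (CS n).2
    simp only [hab, ha2, hb2] at h
    rw [← Sobolev.norm_sq, tsum_mul_left, mul_pow, dbl] at h
    refine le_trans ?_ h
    have h3 : ‖mulCoeff u f n‖ ≤ ∑' k : ℤ, ‖u.coeff (n - k) * f.coeff k‖ :=
      norm_tsum_le_tsum_norm (hsn n)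
    have := Real.rpow_nonneg (jap_pos n).le (2 * s)
    gcongr
  have hR : Summable fun n => ‖f‖ ^ 2 * ∑' k, (F ∘ e) (n, k) := hGs.prod.mul_left _
  have hsum := Summable.of_nonneg_of_le (Sobolev.term_nonneg _) hle hR
  refine ⟨fun n => (hsn n).of_norm, hsum, (hsum.tsum_le_tsum hle hR).trans ?_⟩
  have h1 : ∑' q, (F ∘ e) q = ∑' n, ∑' k, (F ∘ e) (n, k) := hGs.tsum_prod
  rw [tsum_mul_left, ← h1, mul_comm]
  exact mul_le_mul_of_nonneg_right hGt (sq_nonneg _)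

/-- The Fourier coefficients of `T_u f = Π(u f)`, with `Π` the Szegő projector onto the Fourier
modes `n ≥ 0`. -/
def toeplitzCoeff {s : ℝ} (hs : -1 / 2 < s) (hs' : s ≤ 0) (u : Sobolev s) :
    Hardy (1 + s) →ₗ[ℂ] (ℤ → ℂ) where
  toFun f n := if 0 ≤ n then mulCoeff u (f : Sobolev (1 + s)) n else 0
  map_add' f g := by
    ext n
    have h1 := (mul_bound hs hs' u f).1 n
    have h2 := (mul_bound hs hs' u g).1 n
    by_cases hn : 0 ≤ n
    · simp only [hn, if_true, Pi.add_apply, mulCoeff]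
      rw [← h1.tsum_add h2]
      simp [mul_add]
    · simp [hn]
  map_smul' c f := by
    ext n
    by_cases hn : 0 ≤ n
    · simp only [hn, if_true, Pi.smul_apply, smul_eq_mul, mulCoeff, RingHom.id_apply]
      rw [← tsum_mul_left]
      refine tsum_congr fun k => ?_
      simp only [Submodule.coe_smul, Sobolev.coeff_smul, Pi.smul_apply, smul_eq_mul]
      ring
    · simp [hn]

theorem toeplitz_bound {s : ℝ} (hs : -1 / 2 < s) (hs' : s ≤ 0) (u : Sobolev s)
    (f : Hardy (1 + s)) :
    Summable (fun n : ℤ => jap n ^ (2 * s) * ‖toeplitzCoeff hs hs' u f n‖ ^ 2) ∧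
      ∑' n : ℤ, jap n ^ (2 * s) * ‖toeplitzCoeff hs hs' u f n‖ ^ 2 ≤
        (√(prodConst s) * ‖u‖) ^ 2 * ‖f‖ ^ 2 := by
  obtain ⟨-, h1, h2⟩ := mul_bound hs hs' u f
  have hle : ∀ n : ℤ, jap n ^ (2 * s) * ‖toeplitzCoeff hs hs' u f n‖ ^ 2 ≤
      jap n ^ (2 * s) * ‖mulCoeff u (f : Sobolev (1 + s)) n‖ ^ 2 := fun n => by
    by_cases hn : 0 ≤ n
    · simp [toeplitzCoeff, hn]
    · simpa [toeplitzCoeff, hn] using Sobolev.term_nonneg (β := s) (mulCoeff u f.1) n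
  have hsum := Summable.of_nonneg_of_le (Sobolev.term_nonneg _) hle h1
  refine ⟨hsum, (hsum.tsum_le_tsum hle h1).trans (h2.trans (le_of_eq ?_))⟩
  rw [mul_pow, Real.sq_sqrt (prodConst_nonneg s)]
  rfl

/-- The Toeplitz operator `T_u : H^{1+s}_+ → H^s_+`, `T_u f = Π(u f)`, with potential `u ∈ H^s_c`. -/
def toeplitz {s : ℝ} (hs : -1 / 2 < s) (hs' : s ≤ 0) (u : Sobolev s) :
    Hardy (1 + s) →L[ℂ] Hardy s :=
  hardyOp (toeplitzCoeff hs hs' u) (√(prodConst s) * ‖u‖)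
    (mul_nonneg (Real.sqrt_nonneg _) (norm_nonneg _))
    (fun f n hn => by simp [toeplitzCoeff, not_le.2 hn])
    (fun f => (toeplitz_bound hs hs' u f).1)
    (fun f => (toeplitz_bound hs hs' u f).2)

/-- The Lax operator `L_u = D - T_u : H^{1+s}_+ → H^s_+` of the Benjamin-Ono equation. -/
def laxOperator {s : ℝ} (hs : -1 / 2 < s) (hs' : s ≤ 0) (u : Sobolev s) :
    Hardy (1 + s) →L[ℂ] Hardy s :=
  derivOp s - toeplitz hs hs' u

/-- `L_u - z : H^{1+s}_+ → H^s_+`. -/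
def laxSub {s : ℝ} (hs : -1 / 2 < s) (hs' : s ≤ 0) (u : Sobolev s) (z : ℂ) :
    Hardy (1 + s) →L[ℂ] Hardy s :=
  laxOperator hs hs' u - z • incl s

/-- The Riesz projector `P_n(u) = -(2πi)⁻¹ ∮_{|z - n| = 1/3} (L_u - z)⁻¹ dz ∈ ℒ(H^s_+, H^{1+s}_+)`. -/
def rieszProj {s : ℝ} (hs : -1 / 2 < s) (hs' : s ≤ 0) (u : Sobolev s) (n : ℕ) :
    Hardy s →L[ℂ] Hardy (1 + s) :=
  -((2 * Real.pi * Complex.I : ℂ)⁻¹ •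
    ∮ z in C((n : ℂ), 1 / 3), (laxSub hs hs' u z).inverse)

/-- `α_n(u) = ⟨P_n e_n | e_n⟩`. -/
def alpha {s : ℝ} (hs : -1 / 2 < s) (hs' : s ≤ 0) (u : Sobolev s) (n : ℕ) : ℂ :=
  pairing (rieszProj hs hs' u n (expo s n) : Sobolev (1 + s)) (expo (-(1 + s)) n : Sobolev _)

/-- `β_n(u) = ⟨P_n S P_{n-1} e_{n-1} | e_n⟩`, for `n ≥ 1`. -/
def beta {s : ℝ} (hs : -1 / 2 < s) (hs' : s ≤ 0) (u : Sobolev s) (n : ℕ) : ℂ :=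
  pairing
    (rieszProj hs hs' u n
      (incl s (shift (1 + s) (rieszProj hs hs' u (n - 1) (expo s (n - 1))))) : Sobolev (1 + s))
    (expo (-(1 + s)) n : Sobolev _)

/-- `δ_n(u) = β_n(u) - α_n(u)`, for `n ≥ 1`. -/
def delta {s : ℝ} (hs : -1 / 2 < s) (hs' : s ≤ 0) (u : Sobolev s) (n : ℕ) : ℂ :=
  beta hs hs' u n - alpha hs hs' u n

end BenjaminOno

end

noncomputable section

namespace BenjaminOno

/-! ### Square summable sequences with values in a Banach algebra -/

/-! Commuting the Lax operator with the shift costs only a rank-one term: (L_u - z - 1) S f = S (L_u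
- z) f - c e_0, where c is the coefficient of u f at frequency -1 (`laxSub_shift`). With f = (L_u -
z)⁻¹ e_{n-1} and z on the contour around n - 1, this shows that S P_{n-1} e_{n-1} and P_n e_n differ
by a contour integral of scalar multiples of resolvents applied to e_0. Since P_n² = P_n
(`riesz_comp_self`), δ_n is a double contour integral of a product of two scalars (`delta_succ`):
the coefficient at -1 of u (L_u - z)⁻¹ e_{n-1}, and the coefficient at n of a product of two
resolvents applied to e_0. Transposition replaces u by its reflection and turns the second scalar
into the coefficient at 0 of two resolvents applied to e_n (`coeff_inverse_inverse`). Each scalar is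
now a tail, at distance n from the frequency of the unit vector it starts from.

Both tails are square summable in n, for the following reason. After translating frequencies by n,
the resolvent equation reads x = a (y + u ⋆ x) (`laxSub_eq_iff`): the convolution does not depend on
n (`conv_frame`), and the symbol a is bounded by 4 uniformly in n and in z on the contour. For small
u the equations for all n and all contour points are therefore solved at once by a Neumann series in
ℓ²(ℤ; B), where B is the algebra of bounded continuous functions of the parameters. The supremum
over n sits inside the ℓ² sum, so the diagonal entries j = -n of the family are dominated by one ℓ²
sequence.

Cauchy-Schwarz then gives ℓ¹ (`summable_tsum_diag_le`). The weights ⟨n⟩^s and ⟨n⟩^{1+s} of the two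
factors multiply to ⟨n⟩^{1+2s} ≥ 1, so removing them does no harm. The construction uses only
bounded linear and bilinear maps and an operator inverse, hence is analytic near u = 0; boundedness
follows after shrinking the neighbourhood. -/

theorem memlp_two_iff {ι B : Type*} [NormedAddCommGroup B] {x : ι → B} :
    Memℓp (E := fun _ : ι => B) x 2 ↔ Summable fun j => ‖x j‖ ^ 2 := by
  rw [memℓp_gen_iff (by norm_num)]
  simp

theorem lp_two_summable {ι B : Type*} [NormedAddCommGroup B] (x : lp (fun _ : ι => B) 2) :
    Summable fun j => ‖x j‖ ^ 2 :=
  memlp_two_iff.1 (lp.memℓp x)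

theorem lp_two_norm_sq {ι B : Type*} [NormedAddCommGroup B] (x : lp (fun _ : ι => B) 2) :
    ‖x‖ ^ 2 = ∑' j, ‖x j‖ ^ 2 := by
  have := lp.norm_rpow_eq_tsum (p := 2) (by norm_num) x
  simpa using this

theorem lp_two_norm_le {ι B : Type*} [NormedAddCommGroup B] (x : lp (fun _ : ι => B) 2) {C : ℝ}
    (hC : 0 ≤ C) (h : ∑' j, ‖x j‖ ^ 2 ≤ C ^ 2) : ‖x‖ ≤ C :=
  (abs_le_of_sq_le_sq' (by rwa [lp_two_norm_sq]) hC).2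

theorem memlp_two_mul {ι B : Type*} [NormedCommRing B] {a : ι → B} {C : ℝ}
    (ha : ∀ j, ‖a j‖ ≤ C) (x : lp (fun _ : ι => B) 2) :
    Memℓp (E := fun _ : ι => B) (fun j => a j * x j) 2 := by
  refine memlp_two_iff.2 (Summable.of_nonneg_of_le (fun j => sq_nonneg _) (fun j => ?_)
    ((lp_two_summable x).mul_left (C ^ 2)))
  rw [← mul_pow]
  exact pow_le_pow_left₀ (norm_nonneg _) ((norm_mul_le _ _).trans
    (mul_le_mul_of_nonneg_right (ha j) (norm_nonneg _))) 2

/-- Multiplication of a square summable sequence by a bounded sequence. -/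
def lpMul {ι B : Type*} [NormedCommRing B] [NormedAlgebra ℂ B] {a : ι → B} {C : ℝ} (hC : 0 ≤ C)
    (ha : ∀ j, ‖a j‖ ≤ C) : lp (fun _ : ι => B) 2 →L[ℂ] lp (fun _ : ι => B) 2 :=
  LinearMap.mkContinuous
    { toFun := fun x => ⟨fun j => a j * x j, memlp_two_mul ha x⟩
      map_add' := fun x y => by ext j; simp only [lp.coeFn_add, Pi.add_apply, mul_add]
      map_smul' := fun c x => by ext j; simp } C fun x => by
    refine lp_two_norm_le _ (by positivity) ?_
    rw [mul_pow, lp_two_norm_sq, ← tsum_mul_left]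
    refine Summable.tsum_le_tsum (fun j => ?_) (memlp_two_iff.1 (memlp_two_mul ha x))
      ((lp_two_summable x).mul_left (C ^ 2))
    rw [← mul_pow]
    exact pow_le_pow_left₀ (norm_nonneg _) ((norm_mul_le _ _).trans
      (mul_le_mul_of_nonneg_right (ha j) (norm_nonneg _))) 2

@[simp] theorem lpMul_apply {ι B : Type*} [NormedCommRing B] [NormedAlgebra ℂ B] {a : ι → B} {C : ℝ}
    (hC : 0 ≤ C) (ha : ∀ j, ‖a j‖ ≤ C) (x : lp (fun _ : ι => B) 2) (j : ι) :
    lpMul hC ha x j = a j * x j := rfl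

theorem norm_lpMul_le {ι B : Type*} [NormedCommRing B] [NormedAlgebra ℂ B] {a : ι → B} {C : ℝ}
    (hC : 0 ≤ C) (ha : ∀ j, ‖a j‖ ≤ C) : ‖lpMul hC ha‖ ≤ C :=
  LinearMap.mkContinuous_norm_le _ hC _

/-! ### The convolution operator -/

theorem jap_rpow_mul_neg (n : ℤ) (a : ℝ) : jap n ^ a * jap n ^ (-a) = 1 := by
  rw [← Real.rpow_add (jap_pos n)]; simp

theorem jap_rpow_sq (n : ℤ) (a : ℝ) : (jap n ^ a) ^ 2 = jap n ^ (2 * a) := by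
  rw [mul_comm, Real.rpow_mul (jap_pos n).le, Real.rpow_two]

/-- The element of `H^β_c` whose Fourier coefficients are the absolute values of those of `u`. -/
def Sobolev.absCoeff {β : ℝ} (u : Sobolev β) : Sobolev β :=
  Sobolev.mk (fun k => (‖u.coeff k‖ : ℂ)) (by simpa using u.summable)

theorem Sobolev.norm_absCoeff {β : ℝ} (u : Sobolev β) : ‖u.absCoeff‖ = ‖u‖ := by
  simp [Sobolev.norm_def, Sobolev.absCoeff]

/-- The element of `H^β_c` with Fourier coefficients `⟨k⟩^{-β} ‖x k‖`. -/
def Sobolev.ofLp {B : Type*} [NormedAddCommGroup B] (β : ℝ) (x : lp (fun _ : ℤ => B) 2) :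
    Sobolev β :=
  Sobolev.mk (fun k => ((jap k ^ (-β) * ‖x k‖ : ℝ) : ℂ)) (by
    refine (lp_two_summable x).congr fun k => ?_
    have h := jap_rpow_mul_neg k (2 * β)
    rw [Complex.norm_real, Real.norm_eq_abs, sq_abs, mul_pow, jap_rpow_sq, ← mul_assoc, mul_neg, h,
      one_mul])

theorem Sobolev.norm_ofLp {B : Type*} [NormedAddCommGroup B] (β : ℝ) (x : lp (fun _ : ℤ => B) 2) :
    ‖Sobolev.ofLp β x‖ = ‖x‖ := by
  rw [← sq_eq_sq₀ (norm_nonneg _) (norm_nonneg _), Sobolev.norm_sq, lp_two_norm_sq]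
  refine tsum_congr fun k => ?_
  have h := jap_rpow_mul_neg k (2 * β)
  rw [Sobolev.ofLp, Sobolev.coeff_mk, Complex.norm_real, Real.norm_eq_abs, sq_abs, mul_pow,
    jap_rpow_sq, ← mul_assoc, mul_neg, h, one_mul]

section Convolution

variable {B : Type*} [NormedCommRing B] [NormedAlgebra ℂ B]

/-- The terms of the weighted convolution series. -/
def convTerm (s : ℝ) (u : Sobolev s) (x : lp (fun _ : ℤ => B) 2) (j k : ℤ) : B :=
  (u.coeff (j - k) * ((jap k ^ (-(1 + s)) : ℝ) : ℂ)) • x k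

/-- Passing to norms turns a `B`-valued series into the product of two scalar distributions with
nonnegative coefficients, so `mul_bound` controls convolution in any Banach algebra, with the same
constant. -/
theorem norm_convTerm (s : ℝ) (u : Sobolev s) (x : lp (fun _ : ℤ => B) 2) (j k : ℤ) :
    (‖convTerm s u x j k‖ : ℂ) = u.absCoeff.coeff (j - k) * (Sobolev.ofLp (1 + s) x).coeff k := by
  have := Real.rpow_pos_of_pos (jap_pos k) (-(1 + s))
  rw [convTerm, norm_smul, norm_mul, Complex.norm_real, Real.norm_of_nonneg this.le]
  simp [Sobolev.absCoeff, Sobolev.ofLp, mul_assoc]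

theorem summable_norm_convTerm {s : ℝ} (hs : -1 / 2 < s) (hs' : s ≤ 0)
    (u : Sobolev s) (x : lp (fun _ : ℤ => B) 2) (j : ℤ) :
    Summable fun k => ‖convTerm s u x j k‖ := by
  have h := (mul_bound hs hs' u.absCoeff (Sobolev.ofLp (1 + s) x)).1 j
  simp only [← norm_convTerm] at h
  exact_mod_cast h

theorem norm_mulCoeff_abs {s : ℝ} (u : Sobolev s) (x : lp (fun _ : ℤ => B) 2) (j : ℤ) :
    ‖mulCoeff u.absCoeff (Sobolev.ofLp (1 + s) x) j‖ = ∑' k, ‖convTerm s u x j k‖ := by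
  have : mulCoeff u.absCoeff (Sobolev.ofLp (1 + s) x) j =
      ((∑' k, ‖convTerm s u x j k‖ : ℝ) : ℂ) := by
    rw [mulCoeff, Complex.ofReal_tsum]
    exact tsum_congr fun k => (norm_convTerm s u x j k).symm
  rw [this, Complex.norm_real, Real.norm_of_nonneg (tsum_nonneg fun k => norm_nonneg _)]

theorem conv_le {s : ℝ} (hs : -1 / 2 < s) (hs' : s ≤ 0)
    (u : Sobolev s) (x : lp (fun _ : ℤ => B) 2) (j : ℤ) :
    ‖((jap j ^ s : ℝ) : ℂ) • ∑' k, convTerm s u x j k‖ ^ 2 ≤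
      jap j ^ (2 * s) * ‖mulCoeff u.absCoeff (Sobolev.ofLp (1 + s) x) j‖ ^ 2 := by
  have := Real.rpow_pos_of_pos (jap_pos j) s
  rw [norm_smul, Complex.norm_real, Real.norm_of_nonneg this.le, mul_pow, jap_rpow_sq,
    norm_mulCoeff_abs]
  gcongr
  · exact Real.rpow_nonneg (jap_pos j).le _
  · exact norm_tsum_le_tsum_norm (summable_norm_convTerm hs hs' u x j)

theorem memlp_conv {s : ℝ} (hs : -1 / 2 < s) (hs' : s ≤ 0)
    (u : Sobolev s) (x : lp (fun _ : ℤ => B) 2) :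
    Memℓp (E := fun _ : ℤ => B) (fun j => ((jap j ^ s : ℝ) : ℂ) • ∑' k, convTerm s u x j k) 2 :=
  memlp_two_iff.2 (Summable.of_nonneg_of_le (fun _ => sq_nonneg _) (conv_le hs hs' u x)
    (mul_bound hs hs' u.absCoeff (Sobolev.ofLp (1 + s) x)).2.1)

theorem norm_convLp_le {s : ℝ} (hs : -1 / 2 < s) (hs' : s ≤ 0)
    (u : Sobolev s) (x : lp (fun _ : ℤ => B) 2) :
    ‖(⟨_, memlp_conv hs hs' u x⟩ : lp (fun _ : ℤ => B) 2)‖ ≤ √(prodConst s) * ‖u‖ * ‖x‖ := by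
  obtain ⟨-, h1, h2⟩ := mul_bound hs hs' u.absCoeff (Sobolev.ofLp (1 + s) x)
  refine lp_two_norm_le _ (by positivity) ?_
  rw [mul_pow, mul_pow, Real.sq_sqrt (prodConst_nonneg s)]
  rw [Sobolev.norm_absCoeff, Sobolev.norm_ofLp] at h2
  exact ((memlp_two_iff.1 (memlp_conv hs hs' u x)).tsum_le_tsum (conv_le hs hs' u x) h1).trans h2

variable [CompleteSpace B]

theorem summable_convTerm {s : ℝ} (hs : -1 / 2 < s) (hs' : s ≤ 0)
    (u : Sobolev s) (x : lp (fun _ : ℤ => B) 2) (j : ℤ) :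
    Summable fun k => convTerm s u x j k :=
  (summable_norm_convTerm hs hs' u x j).of_norm

/-- The weighted convolution `(u ⋆ x)_j = ⟨j⟩^s ∑_k û(j - k) ⟨k⟩^{-1-s} x_k`, which represents the
product `H^s_c × H^{1+s}_c → H^s_c`. -/
def conv {s : ℝ} (hs : -1 / 2 < s) (hs' : s ≤ 0) :
    Sobolev s →L[ℂ] lp (fun _ : ℤ => B) 2 →L[ℂ] lp (fun _ : ℤ => B) 2 :=
  LinearMap.mkContinuous₂
    (LinearMap.mk₂ ℂ (fun u x => (⟨_, memlp_conv hs hs' u x⟩ : lp (fun _ : ℤ => B) 2))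
      (fun u v x => by
        ext j
        have h : ∀ k, convTerm s (u + v) x j k = convTerm s u x j k + convTerm s v x j k :=
          fun k => by simp [convTerm, add_mul, add_smul]
        simp only [h, lp.coeFn_add, Pi.add_apply]
        rw [(summable_convTerm hs hs' u x j).tsum_add (summable_convTerm hs hs' v x j), smul_add])
      (fun c u x => by
        ext j
        have h : ∀ k, convTerm s (c • u) x j k = c • convTerm s u x j k :=
          fun k => by simp [convTerm, mul_assoc, smul_smul]
        simp only [h, lp.coeFn_smul, Pi.smul_apply]
        rw [(summable_convTerm hs hs' u x j).tsum_const_smul, smul_comm])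
      (fun u x y => by
        ext j
        have h : ∀ k, convTerm s u (x + y) j k = convTerm s u x j k + convTerm s u y j k :=
          fun k => by simp [convTerm]
        simp only [h, lp.coeFn_add, Pi.add_apply]
        rw [(summable_convTerm hs hs' u x j).tsum_add (summable_convTerm hs hs' u y j), smul_add])
      (fun c u x => by
        ext j
        have h : ∀ k, convTerm s u (c • x) j k = c • convTerm s u x j k :=
          fun k => by simp only [convTerm, lp.coeFn_smul, Pi.smul_apply]; rw [smul_comm]
        simp only [h, lp.coeFn_smul, Pi.smul_apply]
        rw [(summable_convTerm hs hs' u x j).tsum_const_smul, smul_comm])) (√(prodConst s))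
    (norm_convLp_le hs hs')

theorem conv_apply {s : ℝ} (hs : -1 / 2 < s) (hs' : s ≤ 0)
    (u : Sobolev s) (x : lp (fun _ : ℤ => B) 2) (j : ℤ) :
    conv hs hs' u x j = ((jap j ^ s : ℝ) : ℂ) • ∑' k, convTerm s u x j k := rfl

theorem norm_conv_le {s : ℝ} (hs : -1 / 2 < s) (hs' : s ≤ 0)
    (u : Sobolev s) :
    ‖(conv hs hs' u : lp (fun _ : ℤ => B) 2 →L[ℂ] _)‖ ≤ √(prodConst s) * ‖u‖ :=
  ContinuousLinearMap.opNorm_le_bound _ (by positivity) (norm_convLp_le hs hs' u)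

end Convolution


section

/-! ### The solution operator of the fixed point equation -/

section Solve

variable {B : Type*} [NormedCommRing B] [NormedAlgebra ℂ B] [CompleteSpace B] {s : ℝ}

/-- The operator `x ↦ a (u ⋆ x)`. -/
def mulConv (hs : -1 / 2 < s) (hs' : s ≤ 0) {a : ℤ → B} {C : ℝ} (hC : 0 ≤ C)
    (ha : ∀ j, ‖a j‖ ≤ C) :
    Sobolev s →L[ℂ] lp (fun _ : ℤ => B) 2 →L[ℂ] lp (fun _ : ℤ => B) 2 :=
  (ContinuousLinearMap.compL ℂ _ _ _ (lpMul hC ha)) ∘L (conv hs hs')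

theorem mulConv_apply (hs : -1 / 2 < s) (hs' : s ≤ 0) {a : ℤ → B} {C : ℝ} (hC : 0 ≤ C)
    (ha : ∀ j, ‖a j‖ ≤ C) (u : Sobolev s) (x : lp (fun _ : ℤ => B) 2) :
    mulConv hs hs' hC ha u x = lpMul hC ha (conv hs hs' u x) := rfl

theorem norm_mulConv_lt (hs : -1 / 2 < s) (hs' : s ≤ 0) {a : ℤ → B} {C : ℝ} (hC : 0 ≤ C)
    (ha : ∀ j, ‖a j‖ ≤ C) {u : Sobolev s} (hu : C * (√(prodConst s) * ‖u‖) < 1) :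
    ‖mulConv hs hs' hC ha u‖ < 1 :=
  ((ContinuousLinearMap.opNorm_comp_le (lpMul hC ha) (conv hs hs' u)).trans
    (mul_le_mul (norm_lpMul_le hC ha) (norm_conv_le hs hs' u) (norm_nonneg _) hC)).trans_lt hu

/-- The solution operator of `x = y + a (u ⋆ x)`. -/
def solve (hs : -1 / 2 < s) (hs' : s ≤ 0) {a : ℤ → B} {C : ℝ} (hC : 0 ≤ C)
    (ha : ∀ j, ‖a j‖ ≤ C) (u : Sobolev s) : lp (fun _ : ℤ => B) 2 →L[ℂ] lp (fun _ : ℤ => B) 2 :=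
  Ring.inverse (1 - mulConv hs hs' hC ha u)

/-- `Ring.inverse` vanishes off the units; smallness of `u` makes the operator a unit, by the
Neumann series. -/
theorem solve_eq (hs : -1 / 2 < s) (hs' : s ≤ 0) {a : ℤ → B} {C : ℝ} (hC : 0 ≤ C)
    (ha : ∀ j, ‖a j‖ ≤ C) {u : Sobolev s} (hu : C * (√(prodConst s) * ‖u‖) < 1)
    (y : lp (fun _ : ℤ => B) 2) :
    solve hs hs' hC ha u y = y + lpMul hC ha (conv hs hs' u (solve hs hs' hC ha u y)) := by
  have h0 : IsUnit (1 - mulConv hs hs' hC ha u) :=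
    isUnit_one_sub_of_norm_lt_one (R := lp (fun _ : ℤ => B) 2 →L[ℂ] lp (fun _ : ℤ => B) 2)
      (norm_mulConv_lt hs hs' hC ha hu)
  have h := Ring.mul_inverse_cancel _ h0
  have h2 := DFunLike.congr_fun h y
  rw [mul_apply_eq_comp, sub_apply,
    one_apply_eq_self, one_apply_eq_self, sub_eq_iff_eq_add] at h2
  exact h2

/-- A strict contraction has no nonzero fixed vector; this yields injectivity of L_u - z. -/
theorem eq_zero_of_eq_mulConv (hs : -1 / 2 < s) (hs' : s ≤ 0) {a : ℤ → B} {C : ℝ} (hC : 0 ≤ C)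
    (ha : ∀ j, ‖a j‖ ≤ C) {u : Sobolev s} (hu : C * (√(prodConst s) * ‖u‖) < 1)
    {x : lp (fun _ : ℤ => B) 2} (hx : x = lpMul hC ha (conv hs hs' u x)) : x = 0 := by
  by_contra h
  have h1 := (mulConv hs hs' hC ha u).le_opNorm x
  rw [mulConv_apply, ← hx] at h1
  have h2 := norm_mulConv_lt hs hs' hC ha hu
  nlinarith [norm_pos_iff.2 h]

/-- `mulConv` is linear in `u` and vanishes at 0, and inversion is analytic at the unit 1.
Analyticity at the single point 0 suffices, because it propagates to a neighbourhood. -/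
theorem analyticAt_solve (hs : -1 / 2 < s) (hs' : s ≤ 0) {a : ℤ → B} {C : ℝ} (hC : 0 ≤ C)
    (ha : ∀ j, ‖a j‖ ≤ C) : AnalyticAt ℂ (fun u : Sobolev s => solve hs hs' hC ha u) 0 := by
  have h1 : AnalyticAt ℂ (Ring.inverse : (lp (fun _ : ℤ => B) 2 →L[ℂ] lp (fun _ : ℤ => B) 2) → _)
      (1 - mulConv hs hs' hC ha 0) := by
    rw [map_zero, sub_zero]
    exact analyticAt_inverse (𝕜 := ℂ) (A := lp (fun _ : ℤ => B) 2 →L[ℂ] lp (fun _ : ℤ => B) 2) 1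
  have h2 : AnalyticAt ℂ (fun u : Sobolev s => mulConv hs hs' hC ha u) 0 :=
    ContinuousLinearMap.analyticAt _ _
  exact AnalyticAt.comp (g := Ring.inverse) h1 (analyticAt_const.sub h2)

end Solve

/-! ### Translated frames -/

/-- A Peetre-type inequality. Its constant depends on the translation `k`, which is harmless: it is
used only to see that translates stay in the space, and no norm bound on `frame` is needed. -/
theorem jap_rpow_add_le (a : ℝ) (m k : ℤ) : jap (m + k) ^ a ≤ (2 * jap k) ^ |a| * jap m ^ a := by
  have p1 := jap_pos m
  have p2 := jap_pos k
  have p3 := jap_pos (m + k)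
  have h1 : jap (m + k) ≤ 2 * jap k * jap m := by
    nlinarith [jap_add_le m k, one_le_jap m, one_le_jap k]
  have h2 : jap m ≤ 2 * jap k * jap (m + k) := by
    have := jap_add_le (m + k) (-k)
    rw [add_neg_cancel_right, jap_neg] at this
    nlinarith [one_le_jap (m + k), one_le_jap k]
  rcases le_total 0 a with ha | ha
  · rw [abs_of_nonneg ha, ← Real.mul_rpow (by positivity) p1.le]
    exact Real.rpow_le_rpow p3.le h1 ha
  · rw [abs_of_nonpos ha, Real.rpow_neg (by positivity), ← Real.inv_rpow (by positivity),
      ← Real.mul_rpow (by positivity) p1.le]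
    refine Real.rpow_le_rpow_of_nonpos (by positivity) ?_ ha
    rw [inv_mul_le_iff₀ (by positivity)]
    exact h2

theorem summable_translate {β : ℝ} {f : ℤ → ℂ} (n : ℤ)
    (hf : Summable fun k : ℤ => jap k ^ (2 * β) * ‖f k‖ ^ 2) :
    Summable fun k : ℤ => jap k ^ (2 * β) * ‖f (k + n)‖ ^ 2 := by
  have h := (Equiv.addRight n).summable_iff.2 (hf.mul_left ((2 * jap (-n)) ^ |2 * β|))
  refine Summable.of_nonneg_of_le (fun k => mul_nonneg (Real.rpow_nonneg (jap_pos k).le _)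
    (sq_nonneg _)) (fun k => ?_) h
  have := jap_rpow_add_le (2 * β) (k + n) (-n)
  rw [add_neg_cancel_right] at this
  simp only [Function.comp, Equiv.coe_addRight, ← mul_assoc]
  exact mul_le_mul_of_nonneg_right this (sq_nonneg _)

theorem norm_ofReal_jap_rpow_mul_sq (β : ℝ) (k : ℤ) (z : ℂ) :
    ‖((jap k ^ β : ℝ) : ℂ) * z‖ ^ 2 = jap k ^ (2 * β) * ‖z‖ ^ 2 := by
  rw [norm_mul, mul_pow, Complex.norm_real, Real.norm_eq_abs, sq_abs, jap_rpow_sq]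

theorem ofReal_jap_rpow_ne_zero (β : ℝ) (k : ℤ) : ((jap k ^ β : ℝ) : ℂ) ≠ 0 := by
  exact_mod_cast (Real.rpow_pos_of_pos (jap_pos k) β).ne'

/-- The weighted Fourier coefficients of `e^{-inx} f`. -/
def frame (β : ℝ) (n : ℤ) : Hardy β →ₗ[ℂ] lp (fun _ : ℤ => ℂ) 2 where
  toFun f := ⟨fun j => ((jap j ^ β : ℝ) : ℂ) * (f : Sobolev β).coeff (j + n), memlp_two_iff.2 (by
    simpa only [norm_ofReal_jap_rpow_mul_sq] using summable_translate n (f : Sobolev β).summable)⟩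
  map_add' f g := by
    ext j
    simp only [Submodule.coe_add, Sobolev.coeff_add, lp.coeFn_add, Pi.add_apply, mul_add]
  map_smul' c f := by ext j; simp; ring

theorem frame_apply (β : ℝ) (n : ℤ) (f : Hardy β) (j : ℤ) :
    frame β n f j = ((jap j ^ β : ℝ) : ℂ) * (f : Sobolev β).coeff (j + n) := rfl

theorem frame_injective (β : ℝ) (n : ℤ) : Function.Injective (frame β n) := by
  intro f g h
  refine Subtype.ext (Sobolev.ext fun k => ?_)
  have h1 : frame β n f (k - n) = frame β n g (k - n) := by rw [h]
  rw [frame_apply, frame_apply, sub_add_cancel] at h1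
  exact mul_left_cancel₀ (ofReal_jap_rpow_ne_zero β _) h1

/-- Vanishing below `-n` is the Hardy condition read in the translated frame. -/
theorem exists_frame_eq (β : ℝ) (n : ℤ) (x : lp (fun _ : ℤ => ℂ) 2) (hx : ∀ j < -n, x j = 0) :
    ∃ f : Hardy β, frame β n f = x := by
  have h1 : Summable fun k : ℤ =>
      jap k ^ (2 * β) * ‖((jap k ^ (-β) : ℝ) : ℂ) * x k‖ ^ 2 := by
    refine (lp_two_summable x).congr fun k => ?_
    have h := jap_rpow_mul_neg k (2 * β)
    rw [norm_ofReal_jap_rpow_mul_sq, ← mul_assoc, mul_neg, h, one_mul]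
  refine ⟨⟨Sobolev.mk _ (summable_translate (-n) h1), fun k hk => ?_⟩, ?_⟩
  · simp [hx (k + -n) (by omega)]
  · ext j
    have h := jap_rpow_mul_neg j β
    rw [frame_apply, Sobolev.coeff_mk, add_neg_cancel_right, ← mul_assoc, ← Complex.ofReal_mul, h,
      Complex.ofReal_one, one_mul]

/-! ### The resolvent equation in translated frames -/

variable {s : ℝ}

/-- Convolution commutes with translation of frequencies, so multiplication by `u` is the same
operator `conv` in every frame. This is the source of uniformity in `n`. -/
theorem conv_frame (hs : -1 / 2 < s) (hs' : s ≤ 0) (u : Sobolev s) (n : ℤ) (f : Hardy (1 + s))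
    (j : ℤ) : conv hs hs' u (frame (1 + s) n f) j =
      ((jap j ^ s : ℝ) : ℂ) * mulCoeff u (f : Sobolev (1 + s)) (j + n) := by
  rw [conv_apply, smul_eq_mul, mulCoeff]
  congr 1
  rw [← (Equiv.addRight n).tsum_eq fun k => u.coeff (j + n - k) * (f : Sobolev (1 + s)).coeff k]
  refine tsum_congr fun k => ?_
  have h : ((jap k ^ (-(1 + s)) : ℝ) : ℂ) * ((jap k ^ (1 + s) : ℝ) : ℂ) = 1 := by
    rw [mul_comm, ← Complex.ofReal_mul, jap_rpow_mul_neg, Complex.ofReal_one]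
  rw [convTerm, smul_eq_mul, frame_apply, Equiv.coe_addRight, add_sub_add_right_eq_sub]
  linear_combination (u.coeff (j - k) * (f : Sobolev (1 + s)).coeff (k + n)) * h

theorem laxSub_coeff (hs : -1 / 2 < s) (hs' : s ≤ 0) (u : Sobolev s) (z : ℂ) (f : Hardy (1 + s))
    {k : ℤ} (hk : 0 ≤ k) : (laxSub hs hs' u z f : Sobolev s).coeff k =
      (k - z) * (f : Sobolev (1 + s)).coeff k - mulCoeff u (f : Sobolev (1 + s)) k := by
  have : (laxSub hs hs' u z f : Sobolev s).coeff k =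
      (k : ℂ) * (f : Sobolev (1 + s)).coeff k - toeplitzCoeff hs hs' u f k -
        z * (f : Sobolev (1 + s)).coeff k := by
    rfl
  rw [this]
  simp only [toeplitzCoeff, LinearMap.coe_mk, AddHom.coe_mk, hk, if_true]
  ring

/-- The symbol `⟨j⟩ (j + n - z)⁻¹` of `⟨D⟩ (D - z)⁻¹` in the frame translated by `n`, restricted to
the frequencies `j + n ≥ 0`. -/
def resSymbol (n : ℤ) (z : ℂ) (j : ℤ) : ℂ := if 0 ≤ j + n then (jap j : ℂ) / (j - (z - n)) else 0

/-- The constant 4 is dictated by `j = 0`, where only ‖μ‖ ≥ 1/4 is available; for `j ≠ 0` the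
distance is at least |j| - 1/3 ≥ 2|j|/3. -/
theorem jap_div_four_le {j : ℤ} {μ : ℂ} (h1 : 1 / 4 ≤ ‖μ‖) (h2 : ‖μ‖ ≤ 1 / 3) :
    jap j / 4 ≤ ‖(j : ℂ) - μ‖ := by
  rcases eq_or_ne j 0 with rfl | hj
  · simp [jap]; linarith
  · have h3 : (1 : ℝ) ≤ |(j : ℝ)| := by exact_mod_cast Int.one_le_abs hj
    have h4 := norm_sub_norm_le (j : ℂ) μ
    rw [Complex.norm_intCast] at h4
    rw [jap, max_eq_right h3]
    linarith

theorem norm_jap_div_le {j : ℤ} {μ : ℂ} (h1 : 1 / 4 ≤ ‖μ‖) (h2 : ‖μ‖ ≤ 1 / 3) :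
    ‖(jap j : ℂ) / (j - μ)‖ ≤ 4 := by
  have h := jap_div_four_le (j := j) h1 h2
  have hj := jap_pos j
  rw [norm_div, Complex.norm_real, Real.norm_of_nonneg hj.le, div_le_iff₀ (by linarith)]
  linarith

theorem norm_resSymbol_le {n : ℤ} {z : ℂ} (h1 : 1 / 4 ≤ ‖z - n‖) (h2 : ‖z - n‖ ≤ 1 / 3) (j : ℤ) :
    ‖resSymbol n z j‖ ≤ 4 := by
  unfold resSymbol
  split_ifs
  · exact norm_jap_div_le h1 h2
  · simp

/-- At frequencies `j + n ≥ 0`, divide the equation by `j + n - z` and redistribute the weights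
⟨j⟩^{1+s} = ⟨j⟩ ⟨j⟩^s. At negative frequencies both sides vanish, since the cut-off in `resSymbol`
plays the role of the Szegő projector. -/
theorem laxSub_eq_iff (hs : -1 / 2 < s) (hs' : s ≤ 0) (u : Sobolev s) {n : ℤ} {z : ℂ}
    (h1 : 1 / 4 ≤ ‖z - n‖) (h2 : ‖z - n‖ ≤ 1 / 3) (f : Hardy (1 + s)) (g : Hardy s) :
    laxSub hs hs' u z f = g ↔ frame (1 + s) n f =
      lpMul zero_le_four (norm_resSymbol_le h1 h2)
        (frame s n g + conv hs hs' u (frame (1 + s) n f)) := by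
  have key : ∀ j : ℤ, 0 ≤ j + n →
      ((laxSub hs hs' u z f : Sobolev s).coeff (j + n) = (g : Sobolev s).coeff (j + n) ↔
        frame (1 + s) n f j = lpMul zero_le_four (norm_resSymbol_le h1 h2)
          (frame s n g + conv hs hs' u (frame (1 + s) n f)) j) := fun j hj => by
    have hne : (j : ℂ) - (z - n) ≠ 0 := by
      have h := jap_div_four_le (j := j) h1 h2
      have := jap_pos j
      exact norm_pos_iff.1 (by linarith)
    have hjs := ofReal_jap_rpow_ne_zero s j
    have hj0 : (jap j : ℂ) ≠ 0 := by exact_mod_cast (jap_pos j).ne'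
    have hj1 : ((jap j ^ (1 + s) : ℝ) : ℂ) = jap j * ((jap j ^ s : ℝ) : ℂ) := by
      rw [Real.rpow_add (jap_pos j), Real.rpow_one, Complex.ofReal_mul]
    rw [lpMul_apply, lp.coeFn_add, Pi.add_apply, conv_frame, frame_apply, frame_apply,
      laxSub_coeff hs hs' u z f hj, hj1, resSymbol, if_pos hj]
    have e1 : ((j + n : ℤ) : ℂ) - z = j - (z - n) := by push_cast; ring
    rw [e1]
    constructor
    · intro h
      rw [← h]
      field_simp
      ring
    · intro h
      field_simp at h
      linear_combination h
  constructor
  · intro h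
    ext j
    by_cases hj : 0 ≤ j + n
    · exact (key j hj).1 (by rw [h])
    · rw [lpMul_apply, frame_apply, resSymbol, if_neg hj, zero_mul, f.2 _ (by omega), mul_zero]
  · intro h
    refine Subtype.ext (Sobolev.ext fun k => ?_)
    by_cases hk : 0 ≤ k
    · have := (key (k - n) (by omega)).2 (by rw [← h])
      rwa [sub_add_cancel] at this
    · rw [(laxSub hs hs' u z f).2 k (by omega), g.2 k (by omega)]

/-- Invertibility holds on a whole annulus, not only on the circle of radius 1/3: the proof that P_n
is a projector needs two concentric contours. -/
theorem isInvertible_laxSub (hs : -1 / 2 < s) (hs' : s ≤ 0) {u : Sobolev s}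
    (hu : 4 * (√(prodConst s) * ‖u‖) < 1) {n : ℤ} {z : ℂ}
    (h1 : 1 / 4 ≤ ‖z - n‖) (h2 : ‖z - n‖ ≤ 1 / 3) : (laxSub hs hs' u z).IsInvertible := by
  have hinj : Function.Injective (laxSub hs hs' u z) := by
    refine (injective_iff_map_eq_zero _).2 fun f hf => ?_
    rw [laxSub_eq_iff hs hs' u h1 h2, map_zero, zero_add] at hf
    have := eq_zero_of_eq_mulConv hs hs' _ _ hu hf
    exact frame_injective (1 + s) n (by rw [this, map_zero])
  have hsurj : Function.Surjective (laxSub hs hs' u z) := fun g => by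
    set x := solve hs hs' zero_le_four (norm_resSymbol_le h1 h2) u
      (lpMul zero_le_four (norm_resSymbol_le h1 h2) (frame s n g)) with hx
    have hx1 := solve_eq hs hs' zero_le_four (norm_resSymbol_le h1 h2) hu
      (lpMul zero_le_four (norm_resSymbol_le h1 h2) (frame s n g))
    rw [← map_add, ← hx] at hx1
    -- The fixed point is a multiple of the symbol, hence vanishes at negative frequencies and comes
    -- from a Hardy function.
    obtain ⟨f, hf⟩ := exists_frame_eq (1 + s) n x fun j hj => by
      rw [hx1, lpMul_apply, resSymbol, if_neg (by omega), zero_mul]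
    exact ⟨f, (laxSub_eq_iff hs hs' u h1 h2 f g).2 (by rw [hf]; exact hx1)⟩
  exact ⟨ContinuousLinearEquiv.ofBijective (laxSub hs hs' u z)
    (LinearMap.ker_eq_bot.2 hinj) (LinearMap.range_eq_top.2 hsurj), rfl⟩

/-! ### Commutation with the shift -/

theorem mulCoeff_shift (u : Sobolev s) (f : Hardy (1 + s)) (k : ℤ) :
    mulCoeff u (shift (1 + s) f : Sobolev (1 + s)) k = mulCoeff u (f : Sobolev (1 + s)) (k - 1) := by
  rw [mulCoeff, mulCoeff, ← (Equiv.subRight (1 : ℤ)).tsum_eq fun l =>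
    u.coeff (k - 1 - l) * (f : Sobolev (1 + s)).coeff l]
  refine tsum_congr fun l => ?_
  rw [Equiv.subRight_apply, sub_sub_sub_cancel_right]
  rfl

/-- D S = S (D + 1), while T_u S and S T_u differ only at frequency 0: there the shift brings in the
coefficient of u f at -1, which the projector inside S T_u has removed. -/
theorem laxSub_shift (hs : -1 / 2 < s) (hs' : s ≤ 0) (u : Sobolev s) (z : ℂ) (f : Hardy (1 + s)) :
    laxSub hs hs' u (z + 1) (shift (1 + s) f) =
      shift s (laxSub hs hs' u z f) - mulCoeff u (f : Sobolev (1 + s)) (-1) • expo s 0 := by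
  refine Subtype.ext (Sobolev.ext fun k => ?_)
  rcases lt_or_ge k 0 with hk | hk
  · rw [(laxSub hs hs' u (z + 1) (shift (1 + s) f)).2 k hk, Submodule.coe_sub]
    exact ((shift s (laxSub hs hs' u z f) -
      mulCoeff u (f : Sobolev (1 + s)) (-1) • expo s 0).2 k hk).symm
  · have e : ((shift s (laxSub hs hs' u z f) -
        mulCoeff u (f : Sobolev (1 + s)) (-1) • expo s 0 : Hardy s) : Sobolev s).coeff k =
        (laxSub hs hs' u z f : Sobolev s).coeff (k - 1) -
        mulCoeff u (f : Sobolev (1 + s)) (-1) * (Pi.single (0 : ℤ) (1 : ℂ) : ℤ → ℂ) k := rfl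
    have e' : (shift (1 + s) f : Sobolev (1 + s)).coeff k = (f : Sobolev (1 + s)).coeff (k - 1) :=
      rfl
    rw [laxSub_coeff hs hs' u _ _ hk, mulCoeff_shift, e, e']
    rcases eq_or_lt_of_le hk with rfl | hk
    · rw [(laxSub hs hs' u z f).2 (0 - 1) (by norm_num), f.2 (0 - 1) (by norm_num)]
      simp
    · rw [laxSub_coeff hs hs' u _ _ (by omega), Pi.single_eq_of_ne (by omega)]
      push_cast
      ring

end

/-! ### Riesz projectors of operator pencils -/

section Riesz

variable {E F : Type*} [NormedAddCommGroup E] [NormedSpace ℂ E]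
  [NormedAddCommGroup F] [NormedSpace ℂ F] {A J : E →L[ℂ] F}

/-- The first resolvent identity, with the inclusion `J` in place of the identity because `A` maps
between different spaces. -/
theorem pencil_inverse_sub {z w : ℂ} (hz : (A - z • J).IsInvertible)
    (hw : (A - w • J).IsInvertible) :
    (A - z • J).inverse - (A - w • J).inverse =
      (z - w) • ((A - z • J).inverse ∘L J ∘L (A - w • J).inverse) := by
  ext y
  have h1 : (A - w • J) ((A - w • J).inverse y) = y := hw.self_apply_inverse y
  have h2 := hz.inverse_apply_self ((A - w • J).inverse y)
  have h3 : (A - z • J) ((A - w • J).inverse y) = y - (z - w) • J ((A - w • J).inverse y) := by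
    nth_rw 2 [← h1]
    simp only [sub_apply, smul_apply, sub_smul]
    abel
  rw [h3, map_sub, map_smul] at h2
  simp only [sub_apply, smul_apply, ContinuousLinearMap.comp_apply]
  exact sub_eq_iff_eq_add'.2 (sub_eq_iff_eq_add.1 h2)

variable [CompleteSpace E]

theorem differentiableAt_pencil_inverse {z : ℂ} (hz : (A - z • J).IsInvertible) :
    DifferentiableAt ℂ (fun w : ℂ => (A - w • J).inverse) z := by
  have h1 : DifferentiableAt ℂ (ContinuousLinearMap.inverse : (E →L[ℂ] F) → _) (A - z • J) :=
    (hz.contDiffAt_map_inverse (n := 1)).differentiableAt one_ne_zero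
  exact DifferentiableAt.comp (g := ContinuousLinearMap.inverse) (f := fun w : ℂ => A - w • J) z h1
    ((differentiableAt_const A).sub (differentiableAt_id.smul_const J))

/-- The classical two-contour argument: the second integral is moved to the smaller circle, and the
resolvent identity splits the product into two terms. The Cauchy integral over the outer circle is
holomorphic inside and integrates to 0 over the inner one; the other term gives -2πi ∮ S. -/
theorem riesz_comp_self {c : ℂ} {r R : ℝ} (hr : 0 < r) (hrR : r < R)
    (h : ∀ z : ℂ, r ≤ ‖z - c‖ → ‖z - c‖ ≤ R → (A - z • J).IsInvertible) :
    (∮ z in C(c, R), (A - z • J).inverse) ∘L J ∘L (∮ z in C(c, R), (A - z • J).inverse) =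
      -((2 * Real.pi * Complex.I : ℂ) • ∮ z in C(c, R), (A - z • J).inverse) := by
  set S : ℂ → F →L[ℂ] E := fun z => (A - z • J).inverse with hS
  have hR : 0 < R := hr.trans hrR
  have hd : ∀ z : ℂ, r ≤ ‖z - c‖ → ‖z - c‖ ≤ R → DifferentiableAt ℂ S z :=
    fun z h1 h2 => differentiableAt_pencil_inverse (h z h1 h2)
  have hsphere : ∀ ρ, r ≤ ρ → ρ ≤ R → ContinuousOn S (Metric.sphere c ρ) := fun ρ h1 h2 z hz => by
    rw [mem_sphere_iff_norm] at hz
    exact (hd z (by rw [hz]; exact h1) (by rw [hz]; exact h2)).continuousAt.continuousWithinAt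
  have hci : CircleIntegrable S c R := (hsphere R hrR.le le_rfl).circleIntegrable hR.le
  have hci' : CircleIntegrable S c r := (hsphere r le_rfl hrR.le).circleIntegrable hr.le
  have hrad : (∮ z in C(c, R), S z) = ∮ z in C(c, r), S z := by
    refine Complex.circleIntegral_eq_of_differentiable_on_annulus_off_countable hr hrR.le
      Set.countable_empty (fun z hz => ?_) fun z hz => ?_
    · simp only [Set.mem_sdiff, Metric.mem_closedBall, Metric.mem_ball, dist_eq_norm, not_lt] at hz
      exact (hd z hz.2 hz.1).continuousAt.continuousWithinAt
    · simp only [Set.mem_sdiff, Metric.mem_closedBall, Metric.mem_ball, dist_eq_norm, not_le] at hz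
      exact hd z hz.1.2.le hz.1.1.le
  -- the Cauchy integral of the resolvent is holomorphic inside the contour
  set g : ℂ → F →L[ℂ] E := fun w => ∮ z in C(c, R), (z - w)⁻¹ • S z with hg
  have hgd : DifferentiableOn ℂ g (Metric.ball c R) := by
    have h1 := hasFPowerSeriesOn_cauchy_integral (R := ⟨R, hR.le⟩) hci hR
    have h2 := h1.differentiableOn.const_smul (2 * Real.pi * Complex.I : ℂ)
    refine (h2.mono (Metric.eball_coe (x := c) (ε := ⟨R, hR.le⟩)).ge).congr fun w _ => ?_
    simp only [hg, Pi.smul_apply]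
    rw [smul_inv_smul₀ Complex.two_pi_I_ne_zero]
    rfl
  have hg0 : (∮ w in C(c, r), g w) = 0 := by
    refine DiffContOnCl.circleIntegral_eq_zero hr.le (DifferentiableOn.diffContOnCl ?_)
    rw [closure_ball c hr.ne']
    exact hgd.mono (Metric.closedBall_subset_ball hrR)
  have key : ∀ w ∈ Metric.sphere c r, (∮ z in C(c, R), S z) ∘L J ∘L S w =
      g w - (2 * Real.pi * Complex.I : ℂ) • S w := fun w hw => by
    have hw' := mem_sphere_iff_norm.1 hw
    have hwb : w ∈ Metric.ball c R := by
      rw [mem_ball_iff_norm, hw']; exact hrR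
    have h1 : (∮ z in C(c, R), S z) ∘L J ∘L S w = ∮ z in C(c, R), S z ∘L J ∘L S w := by
      rw [circleIntegral, circleIntegral]
      have := ContinuousLinearMap.intervalIntegral_comp_comm
        ((ContinuousLinearMap.compL ℂ F F E).flip (J ∘L S w)) hci.out
      simpa using this.symm
    have h2 : ∀ z ∈ Metric.sphere c R, S z ∘L J ∘L S w = (z - w)⁻¹ • S z - (z - w)⁻¹ • S w := by
      intro z hz
      have hz' := mem_sphere_iff_norm.1 hz
      have hne : z - w ≠ 0 := by
        intro h0
        rw [sub_eq_zero.1 h0, hw'] at hz'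
        exact hrR.ne hz'
      rw [← smul_sub]
      have := pencil_inverse_sub (A := A) (J := J) (h z (by rw [hz']; exact hrR.le) hz'.le)
        (h w hw'.ge (by rw [hw']; exact hrR.le))
      simp only [hS]
      rw [this, inv_smul_smul₀ hne]
    have hinv : ContinuousOn (fun z : ℂ => (z - w)⁻¹) (Metric.sphere c R) := by
      refine ContinuousOn.inv₀ (by fun_prop) fun z hz h0 => ?_
      rw [mem_sphere_iff_norm, sub_eq_zero.1 h0, hw'] at hz
      exact hrR.ne hz
    have hi1 : CircleIntegrable (fun z => (z - w)⁻¹ • S z) c R :=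
      (hinv.smul (hsphere R hrR.le le_rfl)).circleIntegrable hR.le
    have hi2 : CircleIntegrable (fun z => (z - w)⁻¹ • S w) c R :=
      (hinv.smul continuousOn_const).circleIntegrable hR.le
    rw [h1, circleIntegral.integral_congr hR.le h2, circleIntegral.integral_sub hi1 hi2,
      circleIntegral.integral_smul_const, circleIntegral.integral_sub_inv_of_mem_ball hwb]
  have hgi : CircleIntegrable g c r :=
    ((hgd.mono (Metric.sphere_subset_closedBall.trans
      (Metric.closedBall_subset_ball hrR))).continuousOn).circleIntegrable hr.le
  have h3 : ∀ P : F →L[ℂ] E, P ∘L J ∘L (∮ z in C(c, r), S z) =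
      ∮ w in C(c, r), P ∘L J ∘L S w := fun P => by
    have := ContinuousLinearMap.intervalIntegral_comp_comm
      (ContinuousLinearMap.compL ℂ F E E (P ∘L J)) hci'.out
    rw [circleIntegral, circleIntegral]
    simpa [ContinuousLinearMap.comp_assoc] using this.symm
  have hsi : CircleIntegrable (fun w => (2 * Real.pi * Complex.I : ℂ) • S w) c r :=
    ((hsphere r le_rfl hrR.le).const_smul (2 * Real.pi * Complex.I : ℂ)).circleIntegrable hr.le
  -- Only the right-hand factor is moved to the inner circle.
  nth_rw 2 [hrad]
  rw [h3, circleIntegral.integral_congr hr.le key, circleIntegral.integral_sub hgi hsi, hg0,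
    circleIntegral.integral_smul, zero_sub, hrad]

/-- Reduces operator-valued contour integrals to scalar integrals over an angle, which can be
compared pointwise. -/
theorem clm_circleIntegral_apply {S : ℂ → F →L[ℂ] E} {c : ℂ} {R : ℝ}
    (hS : Continuous fun θ : ℝ => S (circleMap c R θ)) (y : F) (φ : E →L[ℂ] ℂ) :
    φ ((∮ z in C(c, R), S z) y) =
      ∫ θ in (0 : ℝ)..2 * Real.pi, circleMap 0 R θ * Complex.I * φ (S (circleMap c R θ) y) := by
  have hi : IntervalIntegrable (fun θ : ℝ => deriv (circleMap c R) θ • S (circleMap c R θ))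
      MeasureTheory.volume 0 (2 * Real.pi) := by
    refine Continuous.intervalIntegrable ?_ _ _
    simp only [deriv_circleMap]
    exact ((continuous_circleMap _ _).mul continuous_const).smul hS
  have h := ContinuousLinearMap.intervalIntegral_comp_comm
    (φ ∘L ContinuousLinearMap.apply ℂ E y) hi
  simp only [deriv_circleMap, ContinuousLinearMap.comp_apply, ContinuousLinearMap.apply_apply,
    map_smul, smul_eq_mul] at h
  rw [h, circleIntegral]
  simp only [deriv_circleMap]

end Riesz


section

/-! ### Transposition of the Lax operator -/

/-- The reflection `û(n) ↦ û(-n)`. -/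
def Sobolev.reflect (β : ℝ) : Sobolev β →ₗᵢ[ℂ] Sobolev β where
  toFun u := Sobolev.mk (fun n => u.coeff (-n)) (by
    refine ((Equiv.neg ℤ).summable_iff.2 u.summable).congr fun n => ?_
    simp [jap_neg])
  map_add' u v := rfl
  map_smul' c u := rfl
  norm_map' u := by
    change ‖Sobolev.mk (fun n => u.coeff (-n)) _‖ = ‖u‖
    rw [Sobolev.norm_def, Sobolev.norm_def,
      ← (Equiv.neg ℤ).tsum_eq fun n => jap n ^ (2 * β) * ‖u.coeff n‖ ^ 2]
    simp [jap_neg]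

theorem Sobolev.reflect_coeff {β : ℝ} (u : Sobolev β) (n : ℤ) :
    (Sobolev.reflect β u).coeff n = u.coeff (-n) := rfl

variable {s : ℝ}

/-- The duality of H^s and H^{-s}, combined with H^{1+s} ⊂ H^{-s}, which holds because -s ≤ 1 + s.
-/
theorem summable_norm_mul_norm (hs : -1 / 2 < s) {f : ℤ → ℂ}
    (hf : Summable fun n : ℤ => jap n ^ (2 * s) * ‖f n‖ ^ 2) (g : Sobolev (1 + s)) :
    Summable fun n => ‖f n‖ * ‖g.coeff n‖ := by
  have h1 : Summable fun n : ℤ => (jap n ^ s * ‖f n‖) ^ 2 := by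
    simpa only [mul_pow, jap_rpow_sq] using hf
  have h2 : Summable fun n : ℤ => (jap n ^ (-s) * ‖g.coeff n‖) ^ 2 := by
    simp only [mul_pow, jap_rpow_sq]
    refine Summable.of_nonneg_of_le (Sobolev.term_nonneg _) (fun n => ?_) g.summable
    exact mul_le_mul_of_nonneg_right
      (Real.rpow_le_rpow_of_exponent_le (one_le_jap n) (by linarith)) (sq_nonneg _)
  refine (cauchy_schwarz_tsum (fun n => ?_) (fun n => ?_) h1 h2).1.congr fun n => ?_
  · exact mul_nonneg (Real.rpow_nonneg (jap_pos n).le _) (norm_nonneg _)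
  · exact mul_nonneg (Real.rpow_nonneg (jap_pos n).le _) (norm_nonneg _)
  · linear_combination (‖f n‖ * ‖g.coeff n‖) * jap_rpow_mul_neg n s

theorem summable_mul_coeff (hs : -1 / 2 < s) {f : ℤ → ℂ}
    (hf : Summable fun n : ℤ => jap n ^ (2 * s) * ‖f n‖ ^ 2) (g : Sobolev (1 + s)) :
    Summable fun n => f n * g.coeff n :=
  ((summable_norm_mul_norm hs hf g).congr fun _ => (norm_mul _ _).symm).of_norm

/-- Exchange of the two summations. Absolute convergence of the double series comes from the product
estimate for the distributions with coefficients |û| and |f̂|. The pairing carries no conjugation,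
so the transpose depends complex linearly on `u`. -/
theorem tsum_mulCoeff_mul (hs : -1 / 2 < s) (hs' : s ≤ 0) (u : Sobolev s) (f g : Sobolev (1 + s)) :
    ∑' j, mulCoeff u f j * g.coeff j =
      ∑' k, f.coeff k * mulCoeff (Sobolev.reflect s u) g k := by
  obtain ⟨h1, h2, -⟩ := mul_bound hs hs' u.absCoeff f.absCoeff
  have e1 : ∀ j k, u.absCoeff.coeff (j - k) * f.absCoeff.coeff k =
      ((‖u.coeff (j - k) * f.coeff k‖ : ℝ) : ℂ) := fun j k => by
    simp [Sobolev.absCoeff]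
  have h1' : ∀ j, Summable fun k => ‖u.coeff (j - k) * f.coeff k‖ := fun j => by
    have h := h1 j
    simp only [e1] at h
    exact_mod_cast h
  have e2 : ∀ j, ‖mulCoeff u.absCoeff f.absCoeff j‖ = ∑' k, ‖u.coeff (j - k) * f.coeff k‖ :=
    fun j => by
    rw [mulCoeff]
    simp only [e1]
    rw [← Complex.ofReal_tsum, Complex.norm_real,
      Real.norm_of_nonneg (tsum_nonneg fun k => norm_nonneg _)]
  have h3 := summable_norm_mul_norm hs h2 g
  simp only [e2] at h3
  have h4 : Summable fun p : ℤ × ℤ => ‖u.coeff (p.1 - p.2) * f.coeff p.2 * g.coeff p.1‖ := by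
    refine (summable_prod_of_nonneg fun p => norm_nonneg _).2 ⟨fun j => ?_, ?_⟩
    · simpa only [norm_mul] using (h1' j).mul_right ‖g.coeff j‖
    · refine h3.congr fun j => ?_
      rw [← tsum_mul_right]
      exact tsum_congr fun k => (norm_mul _ _).symm
  calc ∑' j, mulCoeff u f j * g.coeff j
      = ∑' j, ∑' k, u.coeff (j - k) * f.coeff k * g.coeff j :=
        tsum_congr fun j => tsum_mul_right.symm
    _ = ∑' k, ∑' j, u.coeff (j - k) * f.coeff k * g.coeff j :=
        (Summable.tsum_comm (f := fun j k => u.coeff (j - k) * f.coeff k * g.coeff j) h4.of_norm).symm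
    _ = _ := tsum_congr fun k => by
        rw [mulCoeff, ← tsum_mul_left]
        refine tsum_congr fun j => ?_
        rw [Sobolev.reflect_coeff, neg_sub]
        ring

/-- D - z is diagonal, and the Szegő projector disappears when tested against a Hardy function; only
the transposition of multiplication by `u` remains. -/
theorem tsum_laxSub_mul (hs : -1 / 2 < s) (hs' : s ≤ 0) (u : Sobolev s) (z : ℂ)
    (f g : Hardy (1 + s)) :
    ∑' k, (laxSub hs hs' u z f : Sobolev s).coeff k * (g : Sobolev (1 + s)).coeff k =
      ∑' k, (f : Sobolev (1 + s)).coeff k *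
        (laxSub hs hs' (Sobolev.reflect s u) z g : Sobolev s).coeff k := by
  have e1 : ∀ k : ℤ, (laxSub hs hs' u z f : Sobolev s).coeff k * (g : Sobolev (1 + s)).coeff k =
      (k - z) * (f : Sobolev (1 + s)).coeff k * (g : Sobolev (1 + s)).coeff k -
        mulCoeff u (f : Sobolev (1 + s)) k * (g : Sobolev (1 + s)).coeff k := fun k => by
    by_cases hk : 0 ≤ k
    · rw [laxSub_coeff hs hs' u z f hk]; ring
    · rw [g.2 k (by omega)]; ring
  have e2 : ∀ k : ℤ, (f : Sobolev (1 + s)).coeff k *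
      (laxSub hs hs' (Sobolev.reflect s u) z g : Sobolev s).coeff k =
      (k - z) * (f : Sobolev (1 + s)).coeff k * (g : Sobolev (1 + s)).coeff k -
        (f : Sobolev (1 + s)).coeff k * mulCoeff (Sobolev.reflect s u) (g : Sobolev (1 + s)) k :=
    fun k => by
    by_cases hk : 0 ≤ k
    · rw [laxSub_coeff hs hs' _ z g hk]; ring
    · rw [f.2 k (by omega)]; ring
  have s1 := summable_mul_coeff hs (mul_bound hs hs' u f.1).2.1 g.1
  have s2 := summable_mul_coeff hs (mul_bound hs hs' (Sobolev.reflect s u) g.1).2.1 f.1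
  have s3 := (summable_mul_coeff hs (laxSub hs hs' u z f : Sobolev s).summable g.1).congr e1
  -- The diagonal series is not estimated directly: it is the sum of two series already known to
  -- converge.
  have s4 := (s3.add s1).congr fun k => sub_add_cancel _ _
  rw [tsum_congr e1, tsum_congr e2, s4.tsum_sub s1,
    s4.tsum_sub (s2.congr fun k => mul_comm _ _), tsum_mulCoeff_mul hs hs']

theorem tsum_inverse_mul (hs : -1 / 2 < s) (hs' : s ≤ 0) (u : Sobolev s) {z : ℂ}
    (h1 : (laxSub hs hs' u z).IsInvertible)
    (h2 : (laxSub hs hs' (Sobolev.reflect s u) z).IsInvertible) (f g : Hardy s) :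
    ∑' k, (f : Sobolev s).coeff k *
        ((laxSub hs hs' (Sobolev.reflect s u) z).inverse g : Sobolev (1 + s)).coeff k =
      ∑' k, ((laxSub hs hs' u z).inverse f : Sobolev (1 + s)).coeff k * (g : Sobolev s).coeff k := by
  have := tsum_laxSub_mul hs hs' u z ((laxSub hs hs' u z).inverse f)
    ((laxSub hs hs' (Sobolev.reflect s u) z).inverse g)
  rwa [h1.self_apply_inverse, h2.self_apply_inverse] at this

theorem incl_coeff (f : Hardy (1 + s)) :
    (incl s f : Sobolev s).coeff = (f : Sobolev (1 + s)).coeff := by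
  unfold incl
  exact hardyOp_coeff _ _ _ _ _ _ f

theorem expo_coeff (β : ℝ) (n : ℕ) (k : ℤ) :
    (expo β n : Sobolev β).coeff k = if k = n then 1 else 0 := by
  change (Pi.single (n : ℤ) (1 : ℂ) : ℤ → ℂ) k = _
  rw [Pi.single_apply]

/-- Makes the inner resolvent act on e_n instead of e_0. In the frames translated by n, e_n is
always the unit vector at 0, whereas e_0 sits at -n: the supremum over n of that family is 1 at
every j ≤ 0, which is not square summable. -/
theorem coeff_inverse_inverse (hs : -1 / 2 < s) (hs' : s ≤ 0) (u : Sobolev s) {z w : ℂ}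
    (hz : (laxSub hs hs' u z).IsInvertible)
    (hz' : (laxSub hs hs' (Sobolev.reflect s u) z).IsInvertible)
    (hw : (laxSub hs hs' u w).IsInvertible)
    (hw' : (laxSub hs hs' (Sobolev.reflect s u) w).IsInvertible) (m n : ℕ) :
    ((laxSub hs hs' u w).inverse (incl s ((laxSub hs hs' u z).inverse (expo s m))) :
        Sobolev (1 + s)).coeff n =
      ((laxSub hs hs' (Sobolev.reflect s u) z).inverse
        (incl s ((laxSub hs hs' (Sobolev.reflect s u) w).inverse (expo s n))) :
        Sobolev (1 + s)).coeff m := by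
  have h1 := tsum_inverse_mul hs hs' u hw hw' (incl s ((laxSub hs hs' u z).inverse (expo s m)))
    (expo s n)
  have h2 := tsum_inverse_mul hs hs' u hz hz' (expo s m)
    (incl s ((laxSub hs hs' (Sobolev.reflect s u) w).inverse (expo s n)))
  simp only [expo_coeff, mul_ite, ite_mul, mul_one, mul_zero, one_mul, zero_mul, tsum_ite_eq]
    at h1 h2
  rw [← h1, h2, incl_coeff, incl_coeff]

/-! ### An integral formula for `δ_n` -/

theorem pairing_expo {β : ℝ} (f : Sobolev β) (n : ℕ) :
    pairing f (expo (-β) n : Sobolev (-β)) = f.coeff n := by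
  simp [pairing, expo_coeff]

theorem shift_expo (β : ℝ) (n : ℕ) : shift β (expo β n) = expo β (n + 1) := by
  refine Subtype.ext (Sobolev.ext fun k => ?_)
  have : (shift β (expo β n) : Sobolev β).coeff k = (expo β n : Sobolev β).coeff (k - 1) := rfl
  rw [this, expo_coeff, expo_coeff]
  push_cast
  simp only [sub_eq_iff_eq_add]

/-- The `n`-th Fourier coefficient on the Hardy space. -/
def hardyCoeff (β : ℝ) (n : ℤ) : Hardy β →L[ℂ] ℂ := Sobolev.coeffCLM β n ∘L (Hardy β).subtypeL

theorem hardyCoeff_apply {β : ℝ} (n : ℤ) (f : Hardy β) :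
    hardyCoeff β n f = (f : Sobolev β).coeff n := rfl

theorem norm_circleMap_sub (n : ℤ) (θ : ℝ) : ‖circleMap n (1 / 3) θ - n‖ = 1 / 3 := by
  rw [circleMap_sub_center, norm_circleMap_zero]
  norm_num

theorem isInvertible_laxSub_circleMap (hs : -1 / 2 < s) (hs' : s ≤ 0) {u : Sobolev s}
    (hu : 4 * (√(prodConst s) * ‖u‖) < 1) (n : ℤ) (θ : ℝ) :
    (laxSub hs hs' u (circleMap n (1 / 3) θ)).IsInvertible :=
  isInvertible_laxSub hs hs' hu (n := n) (by rw [norm_circleMap_sub]; norm_num)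
    (norm_circleMap_sub n θ).le

theorem continuous_inverse_circleMap (hs : -1 / 2 < s) (hs' : s ≤ 0) {u : Sobolev s}
    (hu : 4 * (√(prodConst s) * ‖u‖) < 1) (n : ℤ) :
    Continuous fun θ : ℝ => (laxSub hs hs' u (circleMap n (1 / 3) θ)).inverse := by
  refine continuous_iff_continuousAt.2 fun θ => ?_
  have h1 : ContinuousAt (fun z : ℂ => (laxSub hs hs' u z).inverse) (circleMap n (1 / 3) θ) :=
    (differentiableAt_pencil_inverse
      (isInvertible_laxSub_circleMap hs hs' hu n θ)).continuousAt
  exact ContinuousAt.comp (f := circleMap n (1 / 3)) h1 (continuous_circleMap _ _).continuousAt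

theorem rieszProj_comp_self (hs : -1 / 2 < s) (hs' : s ≤ 0) {u : Sobolev s}
    (hu : 4 * (√(prodConst s) * ‖u‖) < 1) (n : ℕ) (y : Hardy s) :
    rieszProj hs hs' u n (incl s (rieszProj hs hs' u n y)) = rieszProj hs hs' u n y := by
  have h := riesz_comp_self (A := laxOperator hs hs' u) (J := incl s) (c := (n : ℂ)) (r := 1 / 4)
    (R := 1 / 3) (by norm_num) (by norm_num) fun z h1 h2 =>
      isInvertible_laxSub hs hs' hu (n := n) (by exact_mod_cast h1) (by exact_mod_cast h2)
  have h2 := DFunLike.congr_fun h y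
  simp only [rieszProj, laxSub, neg_apply, smul_apply, map_neg, map_smul,
    ContinuousLinearMap.comp_apply] at h2 ⊢
  rw [h2, smul_neg, smul_neg, neg_neg, inv_smul_smul₀ Complex.two_pi_I_ne_zero,
    smul_neg]

theorem clm_rieszProj (hs : -1 / 2 < s) (hs' : s ≤ 0) {u : Sobolev s}
    (hu : 4 * (√(prodConst s) * ‖u‖) < 1) (n : ℕ) (y : Hardy s) (φ : Hardy (1 + s) →L[ℂ] ℂ) :
    φ (rieszProj hs hs' u n y) = -((2 * Real.pi * Complex.I : ℂ)⁻¹ *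
      ∫ θ in (0 : ℝ)..2 * Real.pi, circleMap 0 (1 / 3) θ * Complex.I *
        φ ((laxSub hs hs' u (circleMap (n : ℤ) (1 / 3) θ)).inverse y)) := by
  rw [rieszProj, neg_apply, smul_apply, map_neg, map_smul, smul_eq_mul, ← Int.cast_natCast,
    clm_circleIntegral_apply (continuous_inverse_circleMap hs hs' hu n)]

/-- Idempotency rewrites α_n as ⟨P_n P_n e_n | e_n⟩, so both terms of δ_n are values of the
functional `φ`. The commutation with the shift then cancels everything except the rank-one
contribution, and expanding the remaining P_n gives the second contour integral. -/
theorem delta_succ (hs : -1 / 2 < s) (hs' : s ≤ 0) {u : Sobolev s}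
    (hu : 4 * (√(prodConst s) * ‖u‖) < 1) (m : ℕ) :
    delta hs hs' u (m + 1) = -((2 * Real.pi * Complex.I : ℂ)⁻¹ ^ 2 *
      ∫ θ in (0 : ℝ)..2 * Real.pi, ∫ θ' in (0 : ℝ)..2 * Real.pi,
        circleMap 0 (1 / 3) θ * Complex.I * (circleMap 0 (1 / 3) θ' * Complex.I) *
        (mulCoeff u ((laxSub hs hs' u (circleMap (m : ℤ) (1 / 3) θ)).inverse (expo s m) :
            Sobolev (1 + s)) (-1) *
          ((laxSub hs hs' u (circleMap ((m + 1 : ℕ) : ℤ) (1 / 3) θ')).inverse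
            (incl s ((laxSub hs hs' u (circleMap ((m + 1 : ℕ) : ℤ) (1 / 3) θ)).inverse (expo s 0))) :
            Sobolev (1 + s)).coeff (m + 1 : ℕ))) := by
  set φ : Hardy (1 + s) →L[ℂ] ℂ :=
    hardyCoeff (1 + s) (m + 1 : ℕ) ∘L rieszProj hs hs' u (m + 1) ∘L incl s with hφ
  have h1 : delta hs hs' u (m + 1) = φ (shift (1 + s) (rieszProj hs hs' u m (expo s m))) -
      φ (rieszProj hs hs' u (m + 1) (expo s (m + 1))) := by
    rw [delta, beta, alpha, pairing_expo, pairing_expo]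
    simp only [hφ, ContinuousLinearMap.comp_apply, rieszProj_comp_self hs hs' hu]
    rfl
  have h2 : ∀ θ : ℝ, (φ ∘L shift (1 + s))
        ((laxSub hs hs' u (circleMap (m : ℤ) (1 / 3) θ)).inverse (expo s m)) =
      φ ((laxSub hs hs' u (circleMap ((m + 1 : ℕ) : ℤ) (1 / 3) θ)).inverse (expo s (m + 1))) -
      mulCoeff u ((laxSub hs hs' u (circleMap (m : ℤ) (1 / 3) θ)).inverse (expo s m) :
            Sobolev (1 + s)) (-1) *
        φ ((laxSub hs hs' u (circleMap ((m + 1 : ℕ) : ℤ) (1 / 3) θ)).inverse (expo s 0)) := by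
    intro θ
    -- The contour around `m + 1` is the one around `m` translated by 1, so both resolvents share
    -- the angle `θ`.
    have e : circleMap ((m + 1 : ℕ) : ℤ) (1 / 3) θ = circleMap (m : ℤ) (1 / 3) θ + 1 := by
      simp only [circleMap]; push_cast; ring
    have h := laxSub_shift hs hs' u (circleMap (m : ℤ) (1 / 3) θ)
      ((laxSub hs hs' u (circleMap (m : ℤ) (1 / 3) θ)).inverse (expo s m))
    rw [(isInvertible_laxSub_circleMap hs hs' hu m θ).self_apply_inverse, shift_expo, ← e] at h
    have h' := congrArg (laxSub hs hs' u (circleMap ((m + 1 : ℕ) : ℤ) (1 / 3) θ)).inverse h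
    rw [(isInvertible_laxSub_circleMap hs hs' hu (m + 1 : ℕ) θ).inverse_apply_self, map_sub,
      map_smul] at h'
    rw [ContinuousLinearMap.comp_apply, h', map_sub, map_smul, smul_eq_mul]
  have hw : Continuous fun θ : ℝ => circleMap 0 (1 / 3) θ * Complex.I :=
    (continuous_circleMap _ _).mul continuous_const
  have hi : ∀ (k : ℕ) (y : Hardy s) (ψ : Hardy (1 + s) →L[ℂ] ℂ), IntervalIntegrable
      (fun θ : ℝ => circleMap 0 (1 / 3) θ * Complex.I *
        ψ ((laxSub hs hs' u (circleMap (k : ℤ) (1 / 3) θ)).inverse y)) MeasureTheory.volume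
      0 (2 * Real.pi) := fun k y ψ => (hw.mul (ψ.continuous.comp
        ((continuous_inverse_circleMap hs hs' hu k).clm_apply continuous_const))).intervalIntegrable
          _ _
  have h3 := clm_rieszProj hs hs' hu m (expo s m) (φ ∘L shift (1 + s))
  have h4 := clm_rieszProj hs hs' hu (m + 1) (expo s (m + 1)) φ
  rw [ContinuousLinearMap.comp_apply] at h3
  rw [h1, h3, h4, neg_sub_neg, ← mul_sub, ← intervalIntegral.integral_sub (hi _ _ _) (hi _ _ _),
    pow_two, mul_assoc (2 * Real.pi * Complex.I : ℂ)⁻¹, ← mul_neg, ← mul_neg,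
    ← intervalIntegral.integral_neg, ← intervalIntegral.integral_const_mul
      (2 * Real.pi * Complex.I : ℂ)⁻¹ (fun x : ℝ => -_)]
  congr 1
  refine intervalIntegral.integral_congr fun θ _ => ?_
  have h5 := clm_rieszProj hs hs' hu (m + 1)
    (incl s ((laxSub hs hs' u (circleMap ((m + 1 : ℕ) : ℤ) (1 / 3) θ)).inverse (expo s 0)))
    (hardyCoeff (1 + s) (m + 1 : ℕ))
  have h6 : φ ((laxSub hs hs' u (circleMap ((m + 1 : ℕ) : ℤ) (1 / 3) θ)).inverse (expo s 0)) = _ :=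
    h5
  simp only [h2, h6, mul_assoc, intervalIntegral.integral_const_mul, mul_left_comm _
    (mulCoeff u ((laxSub hs hs' u (circleMap (m : ℤ) (1 / 3) θ)).inverse (expo s m) :
            Sobolev (1 + s)) (-1)), hardyCoeff_apply]
  ring

end

section

/-! ### Analyticity of linear and bilinear expressions -/

section Analytic

variable {E F G H : Type*} [NormedAddCommGroup E] [NormedSpace ℂ E] [NormedAddCommGroup F]
  [NormedSpace ℂ F] [NormedAddCommGroup G] [NormedSpace ℂ G] [NormedAddCommGroup H]
  [NormedSpace ℂ H]

theorem analyticAt_clm_comp (L : F →L[ℂ] G) {f : E → F} {x : E} (hf : AnalyticAt ℂ f x) :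
    AnalyticAt ℂ (fun y => L (f y)) x :=
  AnalyticAt.comp (g := L) (L.analyticAt _) hf

theorem analyticAt_bilinear_comp (L : F →L[ℂ] G →L[ℂ] H) {f : E → F} {g : E → G} {x : E}
    (hf : AnalyticAt ℂ f x) (hg : AnalyticAt ℂ g x) : AnalyticAt ℂ (fun y => L (f y) (g y)) x :=
  AnalyticAt.comp (g := fun p : F × G => L p.1 p.2) (f := fun y => (f y, g y))
    (L.analyticAt_bilinear _) (hf.prod hg)

theorem analyticAt_clm_apply {f : E → F →L[ℂ] G} {g : E → F} {x : E} (hf : AnalyticAt ℂ f x)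
    (hg : AnalyticAt ℂ g x) : AnalyticAt ℂ (fun y => f y (g y)) x :=
  analyticAt_bilinear_comp (ContinuousLinearMap.id ℂ (F →L[ℂ] G)) hf hg

end Analytic

/-! ### Families of square summable sequences -/

/-- Bounded continuous functions of a frequency `n ∈ ℕ` and of two angles. -/
abbrev Param : Type := BoundedContinuousFunction (ℕ × ℝ × ℝ) ℂ

/-- Evaluation of a family of sequences at a parameter. -/
def evalLp (p : ℕ × ℝ × ℝ) : lp (fun _ : ℤ => Param) 2 →ₗ[ℂ] lp (fun _ : ℤ => ℂ) 2 where
  toFun x := ⟨fun j => x j p, memlp_two_iff.2 (Summable.of_nonneg_of_le (fun _ => sq_nonneg _)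
    (fun j => pow_le_pow_left₀ (norm_nonneg _) ((x j).norm_coe_le_norm p) 2) (lp_two_summable x))⟩
  map_add' x y := by
    ext j
    simp only [lp.coeFn_add, Pi.add_apply, BoundedContinuousFunction.add_apply]
  map_smul' c x := by
    ext j
    simp only [lp.coeFn_smul, Pi.smul_apply, BoundedContinuousFunction.smul_apply, RingHom.id_apply]

theorem evalLp_apply (p : ℕ × ℝ × ℝ) (x : lp (fun _ : ℤ => Param) 2) (j : ℤ) :
    evalLp p x j = x j p := rfl

variable {s : ℝ}

/-- Convolution by the scalar coefficients of `u` acts on each parameter value separately. -/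
theorem evalLp_conv (hs : -1 / 2 < s) (hs' : s ≤ 0) (u : Sobolev s) (p : ℕ × ℝ × ℝ)
    (x : lp (fun _ : ℤ => Param) 2) :
    evalLp p (conv hs hs' u x) = conv hs hs' u (evalLp p x) := by
  ext j
  have h : (∑' k, convTerm s u x j k : Param) p = ∑' k, convTerm s u (evalLp p x) j k := by
    rw [← BoundedContinuousFunction.evalCLM_apply ℂ p,
      ContinuousLinearMap.map_tsum _ (summable_convTerm hs hs' u x j)]
    rfl
  rw [evalLp_apply, conv_apply, conv_apply, BoundedContinuousFunction.smul_apply, h]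

/-- The symbol of `⟨D⟩ (D - z)⁻¹` in all translated frames, with `z` on the contour. -/
def contourSymbol (q : C(ℝ × ℝ, ℝ)) (j : ℤ) : Param :=
  BoundedContinuousFunction.ofNormedAddCommGroup
    (fun p : ℕ × ℝ × ℝ => resSymbol p.1 (circleMap (p.1 : ℤ) (1 / 3) (q p.2)) j)
    (by
      refine continuous_prod_of_discrete_left.2 fun n => ?_
      by_cases hn : 0 ≤ j + n
      · simp only [resSymbol, if_pos hn]
        refine continuous_const.div (continuous_const.sub
          (((continuous_circleMap _ _).comp q.continuous).sub continuous_const)) fun p => ?_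
        have h := jap_div_four_le (j := j) (μ := circleMap (n : ℤ) (1 / 3) (q p) - (n : ℤ))
          (by rw [norm_circleMap_sub]; norm_num) (norm_circleMap_sub n _).le
        have := jap_pos j
        exact norm_pos_iff.1 (by linarith)
      · simp only [resSymbol, if_neg hn]
        exact continuous_const)
    4 fun p => norm_resSymbol_le (by rw [norm_circleMap_sub]; norm_num) (norm_circleMap_sub _ _).le j

theorem contourSymbol_apply (q : C(ℝ × ℝ, ℝ)) (j : ℤ) (p : ℕ × ℝ × ℝ) :
    contourSymbol q j p = resSymbol p.1 (circleMap (p.1 : ℤ) (1 / 3) (q p.2)) j := rfl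

theorem norm_contourSymbol_le (q : C(ℝ × ℝ, ℝ)) (j : ℤ) : ‖contourSymbol q j‖ ≤ 4 :=
  BoundedContinuousFunction.norm_ofNormedAddCommGroup_le _ zero_le_four _

/-- The family of the solutions `f` of `(L_u - z) f = g`, for `z` on the contours. -/
def resolventFamily (hs : -1 / 2 < s) (hs' : s ≤ 0) (q : C(ℝ × ℝ, ℝ)) (u : Sobolev s) :
    lp (fun _ : ℤ => Param) 2 →L[ℂ] lp (fun _ : ℤ => Param) 2 :=
  solve hs hs' zero_le_four (norm_contourSymbol_le q) u ∘L
    lpMul zero_le_four (norm_contourSymbol_le q)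

/-- Evaluation at a parameter respects products and `conv`, so the evaluated family satisfies the
fixed point equation in the frame of that parameter; this equation characterizes the resolvent. -/
theorem evalLp_resolventFamily (hs : -1 / 2 < s) (hs' : s ≤ 0) (q : C(ℝ × ℝ, ℝ)) {u : Sobolev s}
    (hu : 4 * (√(prodConst s) * ‖u‖) < 1) (p : ℕ × ℝ × ℝ) {y : lp (fun _ : ℤ => Param) 2}
    {g : Hardy s} (hy : evalLp p y = frame s p.1 g) :
    evalLp p (resolventFamily hs hs' q u y) = frame (1 + s) p.1
      ((laxSub hs hs' u (circleMap (p.1 : ℤ) (1 / 3) (q p.2))).inverse g) := by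
  have hm : 1 / 4 ≤ ‖circleMap (p.1 : ℤ) (1 / 3) (q p.2) - (p.1 : ℤ)‖ := by
    rw [norm_circleMap_sub]; norm_num
  have hM : ‖circleMap (p.1 : ℤ) (1 / 3) (q p.2) - (p.1 : ℤ)‖ ≤ 1 / 3 := (norm_circleMap_sub _ _).le
  set x := resolventFamily hs hs' q u y with hx
  have h1 : x = lpMul zero_le_four (norm_contourSymbol_le q) (y + conv hs hs' u x) := by
    have := solve_eq hs hs' zero_le_four (norm_contourSymbol_le q) hu
      (lpMul zero_le_four (norm_contourSymbol_le q) y)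
    rw [map_add]
    exact this
  have h2 : evalLp p x = lpMul zero_le_four (norm_resSymbol_le hm hM)
      (frame s p.1 g + conv hs hs' u (evalLp p x)) := by
    rw [← evalLp_conv, ← hy, ← map_add]
    ext j
    conv_lhs => rw [h1]
    rw [evalLp_apply, lpMul_apply, lpMul_apply, BoundedContinuousFunction.mul_apply,
      contourSymbol_apply, evalLp_apply]
  obtain ⟨f, hf⟩ := exists_frame_eq (1 + s) p.1 (evalLp p x) fun j hj => by
    rw [h2, lpMul_apply, resSymbol, if_neg (by omega), zero_mul]
  rw [← hf] at h2 ⊢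
  have h3 := (laxSub_eq_iff hs hs' u hm hM f g).2 h2
  rw [← h3, (isInvertible_laxSub hs hs' hu hm hM).inverse_apply_self]

theorem analyticAt_resolventFamily (hs : -1 / 2 < s) (hs' : s ≤ 0) (q : C(ℝ × ℝ, ℝ)) :
    AnalyticAt ℂ (fun u : Sobolev s => resolventFamily hs hs' q u) 0 :=
  analyticAt_clm_comp ((ContinuousLinearMap.compL ℂ (lp (fun _ : ℤ => Param) 2)
    (lp (fun _ : ℤ => Param) 2) (lp (fun _ : ℤ => Param) 2)).flip
      (lpMul zero_le_four (norm_contourSymbol_le q)))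
    (analyticAt_solve hs hs' zero_le_four (norm_contourSymbol_le q))

/-- The family of the vectors `e_n`, in the frame translated by `n`. -/
def unitFamily : lp (fun _ : ℤ => Param) 2 := lp.single 2 0 1

/-- In its own frame e_n sits at `j = 0` with weight ⟨0⟩^s = 1, so one constant family represents
all n. -/
theorem evalLp_unitFamily (p : ℕ × ℝ × ℝ) : evalLp p unitFamily = frame s p.1 (expo s p.1) := by
  ext j
  rw [evalLp_apply, frame_apply, expo_coeff, unitFamily]
  rcases eq_or_ne j 0 with rfl | hj
  · rw [lp.single_apply_self]
    simp [jap]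
  · rw [lp.single_apply_ne _ _ _ hj, if_neg (by omega)]
    simp

theorem norm_jap_inv_le (j : ℤ) : ‖((jap j : ℂ)⁻¹ • (1 : Param))‖ ≤ 1 := by
  rw [norm_smul, norm_one, mul_one, norm_inv, Complex.norm_real, Real.norm_of_nonneg (jap_pos j).le]
  exact inv_le_one_of_one_le₀ (one_le_jap j)

/-- The inclusion `H^{1+s} → H^s`, for families of weighted coefficients. -/
def inclFamily : lp (fun _ : ℤ => Param) 2 →L[ℂ] lp (fun _ : ℤ => Param) 2 :=
  lpMul zero_le_one norm_jap_inv_le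

theorem evalLp_inclFamily (p : ℕ × ℝ × ℝ) {x : lp (fun _ : ℤ => Param) 2} {f : Hardy (1 + s)}
    (hx : evalLp p x = frame (1 + s) p.1 f) :
    evalLp p (inclFamily x) = frame s p.1 (incl s f) := by
  ext j
  have h : x j p = frame (1 + s) p.1 f j := by rw [← hx, evalLp_apply]
  have hj : (jap j : ℂ) ≠ 0 := by exact_mod_cast (jap_pos j).ne'
  rw [evalLp_apply, inclFamily, lpMul_apply, BoundedContinuousFunction.mul_apply, h, frame_apply,
    frame_apply, incl_coeff, Real.rpow_add (jap_pos j), Real.rpow_one, Complex.ofReal_mul]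
  have h1 : (1 : Param) p = 1 := rfl
  rw [BoundedContinuousFunction.smul_apply, h1, smul_eq_mul]
  field_simp

/-- The families `(L_u - z)⁻¹ e_n`. -/
def colFamily (hs : -1 / 2 < s) (hs' : s ≤ 0) (u : Sobolev s) : lp (fun _ : ℤ => Param) 2 :=
  resolventFamily hs hs' ContinuousMap.fst u unitFamily

/-- The families `(L_v - z)⁻¹ (L_v - z')⁻¹ e_n`. -/
def rowFamily (hs : -1 / 2 < s) (hs' : s ≤ 0) (v : Sobolev s) : lp (fun _ : ℤ => Param) 2 :=
  resolventFamily hs hs' ContinuousMap.fst v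
    (inclFamily (resolventFamily hs hs' ContinuousMap.snd v unitFamily))

theorem analyticAt_colFamily (hs : -1 / 2 < s) (hs' : s ≤ 0) :
    AnalyticAt ℂ (fun u : Sobolev s => colFamily hs hs' u) 0 :=
  analyticAt_clm_apply (analyticAt_resolventFamily hs hs' ContinuousMap.fst) analyticAt_const

theorem analyticAt_rowFamily (hs : -1 / 2 < s) (hs' : s ≤ 0) :
    AnalyticAt ℂ (fun u : Sobolev s => rowFamily hs hs' u) 0 :=
  analyticAt_clm_apply (analyticAt_resolventFamily hs hs' ContinuousMap.fst)
    (analyticAt_clm_comp inclFamily (analyticAt_clm_apply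
      (analyticAt_resolventFamily hs hs' ContinuousMap.snd) analyticAt_const))

theorem conv_colFamily (hs : -1 / 2 < s) (hs' : s ≤ 0) {u : Sobolev s}
    (hu : 4 * (√(prodConst s) * ‖u‖) < 1) (m : ℕ) (θ θ' : ℝ) (j : ℤ) :
    conv hs hs' u (colFamily hs hs' u) j (m, θ, θ') = ((jap j ^ s : ℝ) : ℂ) *
      mulCoeff u ((laxSub hs hs' u (circleMap (m : ℤ) (1 / 3) θ)).inverse (expo s m) :
        Sobolev (1 + s)) (j + m) := by
  rw [← evalLp_apply, evalLp_conv, colFamily,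
    evalLp_resolventFamily hs hs' _ hu _ (evalLp_unitFamily _), conv_frame]
  rfl

theorem rowFamily_apply (hs : -1 / 2 < s) (hs' : s ≤ 0) {v : Sobolev s}
    (hv : 4 * (√(prodConst s) * ‖v‖) < 1) (n : ℕ) (θ θ' : ℝ) (j : ℤ) :
    rowFamily hs hs' v j (n, θ, θ') = ((jap j ^ (1 + s) : ℝ) : ℂ) *
      ((laxSub hs hs' v (circleMap (n : ℤ) (1 / 3) θ)).inverse (incl s
        ((laxSub hs hs' v (circleMap (n : ℤ) (1 / 3) θ')).inverse (expo s n))) :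
        Sobolev (1 + s)).coeff (j + n) := by
  rw [← evalLp_apply, rowFamily, evalLp_resolventFamily hs hs' _ hv _ (evalLp_inclFamily _
    (evalLp_resolventFamily hs hs' _ hv _ (evalLp_unitFamily _))), frame_apply]
  rfl

end

section

/-! ### The map into `ℓ¹` -/

/-- Lebesgue measure on the square `(0, 2π]²`. -/
def squareMeasure : MeasureTheory.Measure (ℝ × ℝ) :=
  (MeasureTheory.volume.restrict (Set.Ioc 0 (2 * Real.pi))).prod
    (MeasureTheory.volume.restrict (Set.Ioc 0 (2 * Real.pi)))

instance : MeasureTheory.IsFiniteMeasure squareMeasure := by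
  unfold squareMeasure; infer_instance

/-- The integrand of the double contour integral of the product of two families. -/
def contourIntegrand (a b : Param) (m : ℕ) (p : ℝ × ℝ) : ℂ :=
  circleMap 0 (1 / 3) p.1 * Complex.I * (circleMap 0 (1 / 3) p.2 * Complex.I) *
    (a (m, p) * b (m + 1, p))

theorem norm_contourIntegrand_le (a b : Param) (m : ℕ) (p : ℝ × ℝ) :
    ‖contourIntegrand a b m p‖ ≤ ‖a‖ * ‖b‖ := by
  have h1 := a.norm_coe_le_norm (m, p)
  have h2 := b.norm_coe_le_norm (m + 1, p)
  have h3 : ‖a (m, p)‖ * ‖b (m + 1, p)‖ ≤ ‖a‖ * ‖b‖ := by gcongr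
  simp only [contourIntegrand, norm_mul, norm_circleMap_zero, Complex.norm_I]
  rw [abs_of_pos (by norm_num : (0 : ℝ) < 1 / 3)]
  -- The two contour factors contribute (1/3)² = 1/9, which is bounded by 1.
  have h4 : 0 ≤ ‖a (m, p)‖ * ‖b (m + 1, p)‖ := by positivity
  linarith

theorem continuous_contourIntegrand (a b : Param) (m : ℕ) :
    Continuous (contourIntegrand a b m) := by
  have h : Continuous fun θ : ℝ => circleMap 0 (1 / 3) θ := continuous_circleMap _ _
  have ha := a.continuous
  have hb := b.continuous
  unfold contourIntegrand
  fun_prop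

theorem integrable_contourIntegrand (a b : Param) (m : ℕ) :
    MeasureTheory.Integrable (contourIntegrand a b m) squareMeasure :=
  MeasureTheory.Integrable.of_bound (continuous_contourIntegrand a b m).aestronglyMeasurable
    (‖a‖ * ‖b‖) (Filter.Eventually.of_forall (norm_contourIntegrand_le a b m))

/-- The double contour integral of the product of two families. -/
def contourIntegral (m : ℕ) (a b : Param) : ℂ := ∫ p, contourIntegrand a b m p ∂squareMeasure

theorem norm_contourIntegral_le (m : ℕ) (a b : Param) :
    ‖contourIntegral m a b‖ ≤ squareMeasure.real Set.univ * (‖a‖ * ‖b‖) := by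
  rw [mul_comm]
  exact MeasureTheory.norm_integral_le_of_norm_le_const
    (Filter.Eventually.of_forall (norm_contourIntegrand_le a b m))

theorem contourIntegral_eq (m : ℕ) (a b : Param) :
    contourIntegral m a b = ∫ θ in (0 : ℝ)..2 * Real.pi, ∫ θ' in (0 : ℝ)..2 * Real.pi,
      circleMap 0 (1 / 3) θ * Complex.I * (circleMap 0 (1 / 3) θ' * Complex.I) *
        (a (m, θ, θ') * b (m + 1, θ, θ')) := by
  have h2 := Real.two_pi_pos.le
  have := integrable_contourIntegrand a b m
  rw [contourIntegral, squareMeasure, MeasureTheory.integral_prod _ this,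
    intervalIntegral.integral_of_le h2]
  refine MeasureTheory.integral_congr_ae (Filter.Eventually.of_forall fun θ => ?_)
  simp only [intervalIntegral.integral_of_le h2]
  rfl

theorem contourIntegral_add_left (m : ℕ) (a a' b : Param) :
    contourIntegral m (a + a') b = contourIntegral m a b + contourIntegral m a' b := by
  rw [contourIntegral, contourIntegral, contourIntegral, ← MeasureTheory.integral_add
    (integrable_contourIntegrand a b m) (integrable_contourIntegrand a' b m)]
  congr 1
  ext p
  simp only [contourIntegrand, BoundedContinuousFunction.add_apply]
  ring

theorem contourIntegral_add_right (m : ℕ) (a b b' : Param) :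
    contourIntegral m a (b + b') = contourIntegral m a b + contourIntegral m a b' := by
  rw [contourIntegral, contourIntegral, contourIntegral, ← MeasureTheory.integral_add
    (integrable_contourIntegrand a b m) (integrable_contourIntegrand a b' m)]
  congr 1
  ext p
  simp only [contourIntegrand, BoundedContinuousFunction.add_apply]
  ring

theorem contourIntegral_smul_left (m : ℕ) (c : ℂ) (a b : Param) :
    contourIntegral m (c • a) b = c * contourIntegral m a b := by
  rw [contourIntegral, contourIntegral, ← MeasureTheory.integral_const_mul]
  congr 1
  ext p
  simp only [contourIntegrand, BoundedContinuousFunction.smul_apply, smul_eq_mul]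
  ring

theorem contourIntegral_smul_right (m : ℕ) (c : ℂ) (a b : Param) :
    contourIntegral m a (c • b) = c * contourIntegral m a b := by
  rw [contourIntegral, contourIntegral, ← MeasureTheory.integral_const_mul]
  congr 1
  ext p
  simp only [contourIntegrand, BoundedContinuousFunction.smul_apply, smul_eq_mul]
  ring

/-- The double contour integrals of the diagonal coefficients of two families, with the weights
`⟨n⟩^{-1-2s}` of the pairing of `H^s` and `H^{1+s}` removed. -/
def diagTerm (s : ℝ) (a b : lp (fun _ : ℤ => Param) 2) (n : ℕ+) : ℂ :=
  ((jap (-(n : ℕ)) ^ (-(1 + 2 * s)) : ℝ) : ℂ) * contourIntegral ((n : ℕ) - 1) (a (-(n : ℕ)))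
    (b (-(n : ℕ)))

/-- The weight has exponent -(1 + 2s) < 0 and base at least 1, so it can be dropped; this uses s >
-1/2. -/
theorem norm_diagTerm_le {s : ℝ} (hs : -1 / 2 < s) (a b : lp (fun _ : ℤ => Param) 2) (n : ℕ+) :
    ‖diagTerm s a b n‖ ≤
      squareMeasure.real Set.univ * (‖a (-(n : ℕ))‖ * ‖b (-(n : ℕ))‖) := by
  have h0 := Real.rpow_nonneg (jap_pos (-(n : ℕ))).le (-(1 + 2 * s))
  have h1 : jap (-(n : ℕ)) ^ (-(1 + 2 * s)) ≤ 1 :=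
    Real.rpow_le_one_of_one_le_of_nonpos (one_le_jap _) (by linarith)
  rw [diagTerm, norm_mul, Complex.norm_real, Real.norm_of_nonneg h0]
  exact (mul_le_of_le_one_left (norm_nonneg _) h1).trans (norm_contourIntegral_le _ _ _)

/-- The norms of `a j` and `b j` already contain the supremum over all frames, so evaluating family
n at `j = -n` costs nothing and Cauchy-Schwarz over the negative integers gives ℓ¹. -/
theorem summable_tsum_diag_le (a b : lp (fun _ : ℤ => Param) 2) :
    Summable (fun n : ℕ+ => ‖a (-(n : ℕ))‖ * ‖b (-(n : ℕ))‖) ∧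
      ∑' n : ℕ+, ‖a (-(n : ℕ))‖ * ‖b (-(n : ℕ))‖ ≤ ‖a‖ * ‖b‖ := by
  obtain ⟨h1, h2⟩ := cauchy_schwarz_tsum (fun k => norm_nonneg (a k)) (fun k => norm_nonneg (b k))
    (lp_two_summable a) (lp_two_summable b)
  have hinj : Function.Injective fun n : ℕ+ => (-(n : ℕ) : ℤ) := fun m n h => by
    simpa using h
  rw [← lp_two_norm_sq, ← lp_two_norm_sq, ← mul_pow] at h2
  exact ⟨h1.comp_injective hinj, (tsum_comp_le_tsum_of_inj h1 (fun k => by positivity) hinj).trans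
    (abs_le_of_sq_le_sq' h2 (by positivity)).2⟩

theorem memlp_diagTerm {s : ℝ} (hs : -1 / 2 < s) (a b : lp (fun _ : ℤ => Param) 2) :
    Memℓp (E := fun _ : ℕ+ => ℂ) (diagTerm s a b) 1 := by
  refine memℓp_gen ?_
  simpa using Summable.of_nonneg_of_le (fun _ => norm_nonneg _) (norm_diagTerm_le hs a b)
    ((summable_tsum_diag_le a b).1.mul_left _)

/-- The bilinear map `(a, b) ↦ (diagTerm s a b n)_n` into `ℓ¹`. -/
def diagMap {s : ℝ} (hs : -1 / 2 < s) : lp (fun _ : ℤ => Param) 2 →L[ℂ]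
    lp (fun _ : ℤ => Param) 2 →L[ℂ] lp (fun _ : ℕ+ => ℂ) 1 :=
  LinearMap.mkContinuous₂
    (LinearMap.mk₂ ℂ (fun a b => (⟨_, memlp_diagTerm hs a b⟩ : lp (fun _ : ℕ+ => ℂ) 1))
      (fun a a' b => by
        ext n
        simp only [diagTerm, lp.coeFn_add, Pi.add_apply, contourIntegral_add_left, mul_add])
      (fun c a b => by
        ext n
        simp only [diagTerm, lp.coeFn_smul, Pi.smul_apply, contourIntegral_smul_left, smul_eq_mul]
        ring)
      (fun a b b' => by
        ext n
        simp only [diagTerm, lp.coeFn_add, Pi.add_apply, contourIntegral_add_right, mul_add])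
      (fun c a b => by
        ext n
        simp only [diagTerm, lp.coeFn_smul, Pi.smul_apply, contourIntegral_smul_right, smul_eq_mul]
        ring)) (squareMeasure.real Set.univ)
    fun a b => by
      obtain ⟨h1, h2⟩ := summable_tsum_diag_le a b
      rw [lp.norm_eq_tsum_rpow (by norm_num)]
      simp only [ENNReal.toReal_one, Real.rpow_one, div_one, LinearMap.mk₂_apply]
      have h3 := Summable.of_nonneg_of_le (fun _ => norm_nonneg _) (norm_diagTerm_le hs a b)
        (h1.mul_left _)
      refine (h3.tsum_le_tsum (norm_diagTerm_le hs a b) (h1.mul_left _)).trans ?_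
      rw [tsum_mul_left, mul_assoc]
      exact mul_le_mul_of_nonneg_left h2 MeasureTheory.measureReal_nonneg

theorem diagMap_apply {s : ℝ} (hs : -1 / 2 < s) (a b : lp (fun _ : ℤ => Param) 2) (n : ℕ+) :
    diagMap hs a b n = diagTerm s a b n := rfl

/-! ### The analytic extension of `δ` -/

variable {s : ℝ}

/-- The sequence `(δ_n(u))_{n ≥ 1}` as an element of `ℓ¹`, for small `u`. -/
def deltaSeq (hs : -1 / 2 < s) (hs' : s ≤ 0) (u : Sobolev s) : lp (fun _ : ℕ+ => ℂ) 1 :=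
  (-(2 * Real.pi * Complex.I : ℂ)⁻¹ ^ 2) • diagMap hs (conv hs hs' u (colFamily hs hs' u))
    (rowFamily hs hs' (Sobolev.reflect s u))

theorem analyticAt_deltaSeq (hs : -1 / 2 < s) (hs' : s ≤ 0) :
    AnalyticAt ℂ (deltaSeq hs hs') 0 := by
  have h1 : AnalyticAt ℂ (fun u : Sobolev s => conv hs hs' u (colFamily hs hs' u)) 0 :=
    analyticAt_clm_apply (f := fun u => conv (B := Param) hs hs' u)
      (ContinuousLinearMap.analyticAt _ _) (analyticAt_colFamily hs hs')
  have h2 : AnalyticAt ℂ (fun u : Sobolev s => rowFamily hs hs' (Sobolev.reflect s u)) 0 :=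
    AnalyticAt.comp_of_eq (g := rowFamily hs hs') (f := Sobolev.reflect s)
      (analyticAt_rowFamily hs hs') ((Sobolev.reflect s).toContinuousLinearMap.analyticAt 0)
      (map_zero (Sobolev.reflect s))
  exact analyticAt_bilinear_comp ((-(2 * Real.pi * Complex.I : ℂ)⁻¹ ^ 2) • diagMap hs) h1 h2

/-- At `j = -(m + 1)`, the frame of `m` sees frequency -1 and the frame of `m + 1` sees frequency 0:
exactly the two coefficients of `delta_succ` after transposition. -/
theorem deltaSeq_apply (hs : -1 / 2 < s) (hs' : s ≤ 0) {u : Sobolev s}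
    (hu : 4 * (√(prodConst s) * ‖u‖) < 1) (n : ℕ+) :
    deltaSeq hs hs' u n = delta hs hs' u n := by
  obtain ⟨m, hm⟩ : ∃ m : ℕ, (n : ℕ) = m + 1 := ⟨(n : ℕ) - 1, by have := n.pos; omega⟩
  have hv : 4 * (√(prodConst s) * ‖Sobolev.reflect s u‖) < 1 := by
    rwa [LinearIsometry.norm_map]
  rw [deltaSeq, lp.coeFn_smul, Pi.smul_apply, diagMap_apply, diagTerm, contourIntegral_eq, hm,
    delta_succ hs hs' hu, smul_eq_mul, neg_mul, Nat.add_sub_cancel,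
    ← intervalIntegral.integral_const_mul]
  congr 2
  refine intervalIntegral.integral_congr fun θ _ => ?_
  rw [← intervalIntegral.integral_const_mul]
  refine intervalIntegral.integral_congr fun θ' _ => ?_
  beta_reduce
  rw [conv_colFamily hs hs' hu, rowFamily_apply hs hs' hv,
    coeff_inverse_inverse hs hs' u (isInvertible_laxSub_circleMap hs hs' hu _ _)
      (isInvertible_laxSub_circleMap hs hs' hv _ _) (isInvertible_laxSub_circleMap hs hs' hu _ _)
      (isInvertible_laxSub_circleMap hs hs' hv _ _),
    show -((m + 1 : ℕ) : ℤ) + (m : ℤ) = -1 by push_cast; ring, neg_add_cancel, Nat.cast_zero]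
  -- The weight in `diagTerm` cancels ⟨j⟩^s from `conv` and ⟨j⟩^{1+s} from the row family.
  have h : ((jap (-((m + 1 : ℕ) : ℤ)) ^ (-(1 + 2 * s)) : ℝ) : ℂ) *
      ((jap (-((m + 1 : ℕ) : ℤ)) ^ s : ℝ) : ℂ) *
      ((jap (-((m + 1 : ℕ) : ℤ)) ^ (1 + s) : ℝ) : ℂ) = 1 := by
    rw [← Complex.ofReal_mul, ← Complex.ofReal_mul, ← Real.rpow_add (jap_pos _),
      ← Real.rpow_add (jap_pos _), show -(1 + 2 * s) + s + (1 + s) = 0 by ring, Real.rpow_zero,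
      Complex.ofReal_one]
  set A := mulCoeff u ((laxSub hs hs' u (circleMap (m : ℤ) (1 / 3) θ)).inverse (expo s m) :
    Sobolev (1 + s)) (-1)
  generalize Sobolev.coeff _ (0 : ℤ) = C
  linear_combination (circleMap 0 (1 / 3) θ * Complex.I * (circleMap 0 (1 / 3) θ' * Complex.I) *
    A * C) * h

end

end BenjaminOno

end

/-! ### The neighbourhood of zero -/

theorem mainTheorem4 (s : ℝ) (hs : -1 / 2 < s) (hs' : s ≤ 0) :
    ∃ U : Set (BenjaminOno.SobolevZero s), IsOpen U ∧ 0 ∈ U ∧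
      -- the contours avoid the spectrum, so that the Riesz projectors are well defined on `U`
      (∀ u ∈ U, ∀ n : ℕ, ∀ z ∈ Metric.sphere (n : ℂ) (1 / 3),
        (BenjaminOno.laxSub hs hs' (u : BenjaminOno.Sobolev s) z).IsInvertible) ∧
      ∃ δ : BenjaminOno.SobolevZero s → lp (fun _ : ℕ+ => ℂ) 1,
        (∀ u ∈ U, ∀ n : ℕ+,
          δ u n = BenjaminOno.delta hs hs' (u : BenjaminOno.Sobolev s) (n : ℕ)) ∧
        AnalyticOnNhd ℂ δ U ∧ Bornology.IsBounded (δ '' U) := by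
  set δ : BenjaminOno.SobolevZero s → lp (fun _ : ℕ+ => ℂ) 1 :=
    fun u => BenjaminOno.deltaSeq hs hs' (u : BenjaminOno.Sobolev s) with hδ
  have ha : AnalyticAt ℂ δ 0 :=
    AnalyticAt.comp_of_eq (g := BenjaminOno.deltaSeq hs hs')
      (f := fun u : BenjaminOno.SobolevZero s => (u : BenjaminOno.Sobolev s))
      (BenjaminOno.analyticAt_deltaSeq hs hs') ((BenjaminOno.SobolevZero s).subtypeL.analyticAt 0)
      (map_zero (BenjaminOno.SobolevZero s).subtypeL)
  -- Three conditions cut out the neighbourhood: analyticity, a bound on `δ` by continuity at 0, and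
  -- the smallness of `u` that identifies `δ` with the actual δ_n and makes the contours avoid the
  -- spectrum.
  have h1 : ∀ᶠ u : BenjaminOno.SobolevZero s in nhds 0, AnalyticAt ℂ δ u :=
    ha.eventually_analyticAt
  have h2 : ∀ᶠ u : BenjaminOno.SobolevZero s in nhds 0, ‖δ u‖ < ‖δ 0‖ + 1 :=
    ha.continuousAt.norm.eventually_lt continuousAt_const (lt_add_one _)
  have h3 : ∀ᶠ u : BenjaminOno.SobolevZero s in nhds 0,
      4 * (√(BenjaminOno.prodConst s) * ‖(u : BenjaminOno.Sobolev s)‖) < 1 := by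
    have hc : Continuous fun u : BenjaminOno.SobolevZero s =>
        4 * (√(BenjaminOno.prodConst s) * ‖(u : BenjaminOno.Sobolev s)‖) := by
      fun_prop
    refine hc.continuousAt.eventually_lt continuousAt_const ?_
    simp
  obtain ⟨U, hU, hUo, hU0⟩ := eventually_nhds_iff.1 (h1.and (h2.and h3))
  refine ⟨U, hUo, hU0, fun u hu n z hz => ?_, δ,
    fun u hu n => BenjaminOno.deltaSeq_apply hs hs' (hU u hu).2.2 n, fun u hu => (hU u hu).1, ?_⟩
  · have hz' : ‖z - ((n : ℤ) : ℂ)‖ = 1 / 3 := by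
      rw [Int.cast_natCast]
      exact mem_sphere_iff_norm.1 hz
    exact BenjaminOno.isInvertible_laxSub hs hs' (hU u hu).2.2 (by rw [hz']; norm_num) hz'.le
  · refine isBounded_iff_forall_norm_le.2 ⟨‖δ 0‖ + 1, ?_⟩
    rintro _ ⟨u, hu, rfl⟩
    exact (hU u hu).2.1.le
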